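/- **Theorem.** Let $k$ be a commutative ring, let $A$ and $B$ be associative unital $k$-algebras, and suppose that $A$ is projective as a $k$-module. All complexes are $\mathbb{Z}$-graded cochain complexes, $T[n]$ is the complex with $T[n]^i=T^{i+n}$ and differential multiplied by $(-1)^n$, and a complex $K$ is *right bounded* if $K^i=0$ for all sufficiently large $i$. Write $\mathcal{C}B$ for the category of complexes of right $B$-modules and $\mathcal{H}B$ for its homotopy category. A *homotopy action* of $A$ on $K\in\mathcal{C}B$ is a unital $k$-algebra homomorphism $\alpha: A\to \mathrm{Hom}_{\mathcal{H}B}(K,K)$. A *strict action* of $A$ on $K$ is a unital $k$-algebra homomorphism $A\to\mathrm{Hom}_{\mathcal{C}B}(K,K)$; equivalently, it is a complex of $A$-$B$-bimodules (with $k$ acting centrally) whose restriction to $B$ is $K$. Every strict action induces a homotopy action. A morphism of complexes $f:K\to K'$ is *compatible* with homotopy actions $\alpha,\alpha'$ on $K,K'$ if $f\circ\alpha(a)$ is homotopic to $\alpha'(a)\circ f$ for every $a\in A$. Let $T$ be a right bounded complex of projective right $B$-modules endowed with a homotopy action of $A$, such that $$\mathrm{Hom}_{\mathcal{H}B}(T,T[-n])=0\quad\text{for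 all } n>0.$$ (a) There are a right bounded complex $X$ of projective right $B$-modules endowed with a strict action of $A$, and a quasi-isomorphism $\varphi:T\to X$ of complexes of right $B$-modules which is compatible with the homotopy actions of $A$. (b) If $\varphi:T\to X$ and $\varphi':T\to X'$ are two quasi-isomorphisms as in (a), then there is a unique isomorphism $\psi:X\to X'$ in the derived category of $A$-$B$-bimodules such that $\psi\circ\varphi=\varphi'$ in $\mathcal{H}B$. (Here the restriction of $\psi$ to the derived category of right $B$-modules is regarded as a morphism of $\mathcal{H}B$: since the underlying complexes of $X$ and $X'$ are right bounded with projective components, $\mathrm{Hom}_{\mathcal{H}B}(X,X')$ maps bijectively onto the morphisms $X\to X'$ in the derived category of right $B$-modules.) -/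

import Mathlib

open CategoryTheory
open scoped TensorProduct ModuleCat.Algebra

universe u w₁ w₂

namespace HomotopyActions

section Bimodules

variable (k A B : Type u) [CommRing k] [Ring A] [Algebra k A] [Ring B] [Algebra k B]

/-- Right `B`-modules, as left modules over the opposite ring. For a `k`-algebra `B` this category
is `k`-linear, and so are its category of complexes and its homotopy category. -/
abbrev RightMod (B : Type u) [Ring B] := ModuleCat.{u} Bᵐᵒᵖ

/-- `A`-`B`-bimodules on which `k` acts centrally, i.e. left modules over `A ⊗ Bᵒᵖ`. -/
abbrev BimodCat := ModuleCat.{u} (A ⊗[k] Bᵐᵒᵖ)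

/-- The homotopy category of (unbounded, cohomologically graded) complexes of right `B`-modules. -/
abbrev HtpyCat (B : Type u) [Ring B] := HomotopyCategory (RightMod B) (ComplexShape.up ℤ)

/-- The canonical functor from complexes of right `B`-modules to the homotopy category. -/
abbrev toHtpy (B : Type u) [Ring B] : CochainComplex (RightMod B) ℤ ⥤ HtpyCat B :=
  HomotopyCategory.quotient (RightMod B) (ComplexShape.up ℤ)

/-- The (exact) restriction functor from `A`-`B`-bimodules to right `B`-modules. -/
noncomputable abbrev restrictRight : BimodCat k A B ⥤ RightMod B :=
  ModuleCat.restrictScalars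
    ((Algebra.TensorProduct.includeRight : Bᵐᵒᵖ →ₐ[k] A ⊗[k] Bᵐᵒᵖ) : Bᵐᵒᵖ →+* A ⊗[k] Bᵐᵒᵖ)

theorem restrictRight_exact (S : ShortComplex (BimodCat k A B)) (hS : S.Exact) :
    (S.map (restrictRight k A B)).Exact := by
  rw [ShortComplex.ShortExact.moduleCat_exact_iff_function_exact] at hS ⊢
  exact hS

instance restrictRight_preservesFiniteLimits :
    Limits.PreservesFiniteLimits (restrictRight k A B) := by
  have := ((Functor.exact_tfae (restrictRight k A B)).out 1 3).mp (restrictRight_exact k A B)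
  exact this.1

instance restrictRight_preservesFiniteColimits :
    Limits.PreservesFiniteColimits (restrictRight k A B) := by
  have := ((Functor.exact_tfae (restrictRight k A B)).out 1 3).mp (restrictRight_exact k A B)
  exact this.2

/-- The complex of right `B`-modules underlying a complex of `A`-`B`-bimodules. -/
noncomputable abbrev resComplex :
    CochainComplex (BimodCat k A B) ℤ ⥤ CochainComplex (RightMod B) ℤ :=
  (restrictRight k A B).mapHomologicalComplex (ComplexShape.up ℤ)

variable {k A B}

/-- A complex is right bounded if its components vanish in all large cohomological degrees. -/
def RightBounded (K : CochainComplex (RightMod B) ℤ) : Prop :=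
  ∃ N : ℤ, K.IsStrictlyLE N

/-- All components are projective right `B`-modules. -/
def ProjectiveComponents (K : CochainComplex (RightMod B) ℤ) : Prop :=
  ∀ i : ℤ, Module.Projective Bᵐᵒᵖ (K.X i)

/-- Left multiplication by `a : A` on a bimodule, a right `B`-linear map. -/
noncomputable def leftMulLinear (M : BimodCat k A B) (a : A) :
    (restrictRight k A B).obj M ⟶ (restrictRight k A B).obj M :=
  ModuleCat.ofHom (X := (restrictRight k A B).obj M) (Y := (restrictRight k A B).obj M)
    { toFun := fun (x : M) => ((a ⊗ₜ[k] (1 : Bᵐᵒᵖ) : A ⊗[k] Bᵐᵒᵖ) • x : M)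
      map_add' := fun (x y : M) => smul_add (a ⊗ₜ[k] (1 : Bᵐᵒᵖ) : A ⊗[k] Bᵐᵒᵖ) x y
      map_smul' := fun b (x : M) => by
        change (a ⊗ₜ[k] (1 : Bᵐᵒᵖ) : A ⊗[k] Bᵐᵒᵖ) • (((1 : A) ⊗ₜ[k] b : A ⊗[k] Bᵐᵒᵖ) • x) =
          ((1 : A) ⊗ₜ[k] b : A ⊗[k] Bᵐᵒᵖ) • ((a ⊗ₜ[k] (1 : Bᵐᵒᵖ) : A ⊗[k] Bᵐᵒᵖ) • x)
        rw [← mul_smul, ← mul_smul]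
        simp }

/-- Left multiplication by `a : A` on a complex of bimodules, an endomorphism of the underlying
complex of right `B`-modules. -/
noncomputable def leftMul (X : CochainComplex (BimodCat k A B) ℤ) (a : A) :
    (resComplex k A B).obj X ⟶ (resComplex k A B).obj X where
  f i := leftMulLinear (X.X i) a
  comm' i j _ := by
    ext (x : X.X i)
    exact ((X.d i j).hom.map_smul (a ⊗ₜ[k] (1 : Bᵐᵒᵖ) : A ⊗[k] Bᵐᵒᵖ) x)

variable (k A B) in
/-- A homotopy action of `A` on a complex `K` of right `B`-modules: a (unital) homomorphism of
`k`-algebras from `A` to the endomorphism algebra of `K` in the homotopy category. -/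
abbrev HomotopyAction (K : CochainComplex (RightMod B) ℤ) :=
  A →ₐ[k] End ((toHtpy B).obj K)

/-- A complex `X` of `A`-`B`-bimodules is the same as a complex of right `B`-modules with a strict
action of `A`; this is the strict action on the underlying complex of right `B`-modules. -/
noncomputable def strictAction (X : CochainComplex (BimodCat k A B) ℤ) :
    A →ₐ[k] End ((resComplex k A B).obj X) where
  toFun a := leftMul X a
  map_one' := by
    refine HomologicalComplex.hom_ext _ _ fun i => ModuleCat.hom_ext (LinearMap.ext ?_)
    intro (x : X.X i)
    exact one_smul (A ⊗[k] Bᵐᵒᵖ) x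
  map_mul' a b := by
    refine HomologicalComplex.hom_ext _ _ fun i => ModuleCat.hom_ext (LinearMap.ext ?_)
    intro (x : X.X i)
    change ((a * b) ⊗ₜ[k] (1 : Bᵐᵒᵖ) : A ⊗[k] Bᵐᵒᵖ) • x =
      (a ⊗ₜ[k] (1 : Bᵐᵒᵖ) : A ⊗[k] Bᵐᵒᵖ) • ((b ⊗ₜ[k] (1 : Bᵐᵒᵖ) : A ⊗[k] Bᵐᵒᵖ) • x)
    rw [← mul_smul, Algebra.TensorProduct.tmul_mul_tmul, one_mul]
  map_zero' := by
    refine HomologicalComplex.hom_ext _ _ fun i => ModuleCat.hom_ext (LinearMap.ext ?_)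
    intro (x : X.X i)
    change ((0 : A) ⊗ₜ[k] (1 : Bᵐᵒᵖ) : A ⊗[k] Bᵐᵒᵖ) • x = 0
    rw [TensorProduct.zero_tmul]
    exact zero_smul (A ⊗[k] Bᵐᵒᵖ) x
  map_add' a b := by
    refine HomologicalComplex.hom_ext _ _ fun i => ModuleCat.hom_ext (LinearMap.ext ?_)
    intro (x : X.X i)
    change ((a + b) ⊗ₜ[k] (1 : Bᵐᵒᵖ) : A ⊗[k] Bᵐᵒᵖ) • x =
      (a ⊗ₜ[k] (1 : Bᵐᵒᵖ) : A ⊗[k] Bᵐᵒᵖ) • x + (b ⊗ₜ[k] (1 : Bᵐᵒᵖ) : A ⊗[k] Bᵐᵒᵖ) • x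
    rw [TensorProduct.add_tmul, add_smul]
  commutes' c := by
    refine HomologicalComplex.hom_ext _ _ fun i => ModuleCat.hom_ext (LinearMap.ext ?_)
    intro (x : X.X i)
    change ((algebraMap k A c) ⊗ₜ[k] (1 : Bᵐᵒᵖ) : A ⊗[k] Bᵐᵒᵖ) • x =
      ((1 : A) ⊗ₜ[k] (algebraMap k Bᵐᵒᵖ c) : A ⊗[k] Bᵐᵒᵖ) • x
    rw [Algebra.algebraMap_eq_smul_one, Algebra.algebraMap_eq_smul_one, TensorProduct.smul_tmul]

/-- The homotopy action induced by the strict action on a complex of bimodules. -/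
noncomputable def inducedHomotopyAction (X : CochainComplex (BimodCat k A B) ℤ) :
    HomotopyAction k A B ((resComplex k A B).obj X) where
  toFun a := (toHtpy B).map (strictAction X a)
  map_one' := by rw [map_one]; exact (toHtpy B).map_id _
  map_mul' a b := by rw [map_mul]; exact (toHtpy B).map_comp _ _
  map_zero' := by rw [map_zero]; exact (toHtpy B).map_zero _ _
  map_add' a b := by rw [map_add]; exact (toHtpy B).map_add
  commutes' c := by
    rw [AlgHom.commutes, Algebra.algebraMap_eq_smul_one, Algebra.algebraMap_eq_smul_one]
    exact ((toHtpy B).map_smul _ _).trans (congrArg (c • ·) ((toHtpy B).map_id _))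

/-- A morphism of complexes `f` is compatible with homotopy actions `α`, `β` if `f ∘ α a` and
`β a ∘ f` are homotopic for all `a`, i.e. equal in the homotopy category. -/
def Compatible {K L : CochainComplex (RightMod B) ℤ} (α : HomotopyAction k A B K)
    (β : HomotopyAction k A B L) (f : K ⟶ L) : Prop :=
  ∀ a : A, (show (toHtpy B).obj K ⟶ (toHtpy B).obj K from α a) ≫ (toHtpy B).map f =
    (toHtpy B).map f ≫ (show (toHtpy B).obj L ⟶ (toHtpy B).obj L from β a)

/-- `(X, φ)` is a strictification of the homotopy action `α` on `T`: `X` is a complex of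
bimodules (that is, a complex of right `B`-modules with a strict action of `A`) which over `B` is right bounded with projective components,
and `φ` is a quasi-isomorphism of complexes of right `B`-modules compatible with the homotopy actions. -/
structure IsStrictification {T : CochainComplex (RightMod B) ℤ} (α : HomotopyAction k A B T)
    (X : CochainComplex (BimodCat k A B) ℤ) (φ : T ⟶ (resComplex k A B).obj X) : Prop where
  rightBounded : RightBounded ((resComplex k A B).obj X)
  projective : ProjectiveComponents ((resComplex k A B).obj X)
  quasiIso : QuasiIso φ
  compatible : Compatible α (inducedHomotopyAction X) φ

/-- A homotopy class `g` of morphisms between the underlying complexes of right `B`-modules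
represents a morphism `ψ` of the derived category of bimodules if the restriction of `ψ` to the
derived category of right `B`-modules is the image of `g`. (If the underlying complexes are right
bounded with projective components, each `ψ` is represented by exactly one `g`, which is `ψ`
regarded as a morphism of the homotopy category.) `HasDerivedCategory` only
chooses a model of the derived category: one always exists, and any two are equivalent. -/
def Represents [HasDerivedCategory.{w₁} (BimodCat k A B)] [HasDerivedCategory.{w₂} (RightMod B)]
    {X X' : CochainComplex (BimodCat k A B) ℤ}
    (g : (toHtpy B).obj ((resComplex k A B).obj X) ⟶ (toHtpy B).obj ((resComplex k A B).obj X'))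
    (ψ : DerivedCategory.Q.obj X ⟶ DerivedCategory.Q.obj X') : Prop :=
  (restrictRight k A B).mapDerivedCategory.map ψ ≫
      (restrictRight k A B).mapDerivedCategoryFactors.hom.app X' =
    (restrictRight k A B).mapDerivedCategoryFactors.hom.app X ≫
      (DerivedCategory.quotientCompQhIso (RightMod B)).inv.app _ ≫
      DerivedCategory.Qh.map g ≫
      (DerivedCategory.quotientCompQhIso (RightMod B)).hom.app _

end Bimodules

end HomotopyActions

/-!
Let `𝒞` and `𝒟` be the homotopy categories of complexes of right `B`-modules and of
`A`-`B`-bimodules, let `R : 𝒟 ⥤ 𝒞` be the restriction functor and `F : 𝒞 ⥤ 𝒟` its left adjoint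
`V ↦ A ⊗ V`. Since `A` is projective over `k`, maps `A ⊗ V ⟶ Z` in `𝒞` are the same as `k`-linear
maps `A → Hom(V, Z)` (`exists_htpy_desc`, `htpy_hom_ext`). So a homotopy action of `A` on `T` is the
same as an algebra structure `m : R (F T) ⟶ T` over the monad `R F` on `𝒞`, and a strict action is
an object of `𝒟`: the question is to lift an algebra over the monad to `𝒟`.

This is done for an abstract adjunction between triangulated categories (`exists_universal_lift`)
by a tower `X₀ ⟶ X₁ ⟶ ⋯` in `𝒟`, with `X₀ = F T`. Each `R Xₙ` comes with an equivariant split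
epimorphism `rₙ : R Xₙ ⟶ T`, with `r₀ = m`, and `Xₙ₊₁` is the cone of the map `F Kₙ ⟶ Xₙ` adjoint
to the inclusion of the kernel `Kₙ` of `rₙ` (`Stage.exists_next`). That `rₙ` extends to an
equivariant map `rₙ₊₁` needs the vanishing of `Hom(R F R F Kₙ⟦1⟧, T)`, which follows from the
hypothesis on `T`: the functor `R F` preserves the vanishing of maps to a given object, and `Kₙ` is
a direct summand of an iterated extension of objects `R F K` with such vanishing. Because
`R Xₙ ⟶ R Xₙ₊₁` factors through `T`, the homotopy colimit `X` of the tower satisfies `R X ≅ T`.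

By the same vanishing, each equivariant map from `T` to `R Y`, where `Y` satisfies the analogue of
the hypothesis on `T`, extends along the tower to a map `X ⟶ Y`, and this map is unique. This
universal property yields both the existence and the uniqueness of the comparison isomorphism:
`X` is represented by a right bounded complex of projective bimodules, hence is K-projective, so
morphisms out of it in the derived category of bimodules are homotopy classes
(`exists_Q_map_eq`), and the universal property says which of them restrict to a given map. Any
strictification is thus isomorphic to `X` in the derived category, compatibly with the maps
from `T` and in only one way.
-/

namespace HomotopyActions

/-! ### Lifting an algebra over the monad of a triangulated adjunction -/

section Triangulated

set_option linter.unusedSectionVars false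

open Limits Pretriangulated

variable {𝒞 : Type*} [Category* 𝒞] [Preadditive 𝒞] [HasZeroObject 𝒞] [HasShift 𝒞 ℤ]
  [∀ n : ℤ, (shiftFunctor 𝒞 n).Additive] [Pretriangulated 𝒞]

/-- The objects `V` with `Hom(V, T⟦-n⟧) = 0` for all `n > 0`. -/
def negOrth (T : 𝒞) : ObjectProperty 𝒞 :=
  fun V => ∀ n : ℤ, 0 < n → ∀ f : V ⟶ T⟦-n⟧, f = 0

lemma negOrth.retract {T V W : 𝒞} (h : negOrth T W) (i : V ⟶ W) (p : W ⟶ V)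
    (hip : i ≫ p = 𝟙 V) : negOrth T V := fun n hn f => by
  rw [← Category.id_comp f, ← hip, Category.assoc, h n hn (p ≫ f), comp_zero]

lemma negOrth.of_iso_right {T T' V : 𝒞} (h : negOrth T V) (e : T ≅ T') : negOrth T' V :=
  fun n hn f => by
    have := h n hn (f ≫ e.inv⟦-n⟧')
    rwa [Preadditive.IsIso.comp_right_eq_zero] at this

lemma negOrth.shift {T V : 𝒞} (h : negOrth T V) : negOrth T (V⟦(1 : ℤ)⟧) := fun n hn f => by
  apply (shiftFunctor 𝒞 (-1 : ℤ)).map_injective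
  rw [Functor.map_zero]
  have := h (n + 1) (by lia) ((shiftFunctorCompIsoId 𝒞 (1 : ℤ) (-1) (by lia)).inv.app V ≫
    f⟦(-1 : ℤ)⟧' ≫ (shiftFunctorAdd' 𝒞 (-n) (-1) (-(n + 1)) (by lia)).inv.app T)
  simpa using this

lemma negOrth.eq_zero_of_shift {T V : 𝒞} (h : negOrth T V) (f : V⟦(1 : ℤ)⟧ ⟶ T) : f = 0 := by
  apply (shiftFunctor 𝒞 (-1 : ℤ)).map_injective
  rw [Functor.map_zero]
  have := h 1 (by lia) ((shiftFunctorCompIsoId 𝒞 (1 : ℤ) (-1) (by lia)).inv.app V ≫ f⟦(-1 : ℤ)⟧')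
  simpa using this

lemma negOrth.obj₂ {T : 𝒞} {Δ : Triangle 𝒞} (hΔ : Δ ∈ distTriang 𝒞) (h₁ : negOrth T Δ.obj₁)
    (h₃ : negOrth T Δ.obj₃) : negOrth T Δ.obj₂ := fun n hn f => by
  obtain ⟨g, rfl⟩ := Triangle.yoneda_exact₂ Δ hΔ f (h₁ n hn _)
  rw [h₃ n hn g, comp_zero]

lemma negOrth.obj₃ {T : 𝒞} {Δ : Triangle 𝒞} (hΔ : Δ ∈ distTriang 𝒞) (h₁ : negOrth T Δ.obj₁)
    (h₂ : negOrth T Δ.obj₂) : negOrth T Δ.obj₃ :=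
  negOrth.obj₂ (rot_of_distTriang _ hΔ) h₂ h₁.shift

lemma exists_factor_of_distTriang {X Y Z W : 𝒞} {f : X ⟶ Y} {g : Y ⟶ Z} {h : Z ⟶ X⟦(1 : ℤ)⟧}
    (H : Triangle.mk f g h ∈ distTriang 𝒞) (k : Y ⟶ W) (hk : f ≫ k = 0) : ∃ l : Z ⟶ W, k = g ≫ l :=
  Triangle.yoneda_exact₂ _ H k hk

lemma eq_of_distTriang {X Y Z W : 𝒞} {f : X ⟶ Y} {g : Y ⟶ Z} {h : Z ⟶ X⟦(1 : ℤ)⟧}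
    (H : Triangle.mk f g h ∈ distTriang 𝒞) (hX : ∀ l : X⟦(1 : ℤ)⟧ ⟶ W, l = 0) {k k' : Z ⟶ W}
    (hk : g ≫ k = g ≫ k') : k = k' := by
  obtain ⟨l, hl⟩ : ∃ l, k - k' = h ≫ l := Triangle.yoneda_exact₃ _ H (k - k') (by
    change g ≫ (k - k') = 0
    rw [Preadditive.comp_sub, hk, sub_self])
  rw [← sub_eq_zero, hl, hX l, comp_zero]

lemma negOrth.cofan {T : 𝒞} {ι : Type*} {X : ι → 𝒞} {c : Cofan X} (hc : IsColimit c)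
    (h : ∀ i, negOrth T (X i)) : negOrth T c.pt := fun n hn f =>
  Cofan.IsColimit.hom_ext hc _ _ fun i => by rw [h i n hn (c.inj i ≫ f), comp_zero]

variable {𝒟 : Type*} [Category* 𝒟] [Preadditive 𝒟] [HasZeroObject 𝒟] [HasShift 𝒟 ℤ]
  [∀ n : ℤ, (shiftFunctor 𝒟 n).Additive] [Pretriangulated 𝒟]
  {F : 𝒞 ⥤ 𝒟} {R : 𝒟 ⥤ 𝒞} [R.CommShift ℤ]

lemma negOrth.leftAdjoint {V : 𝒞} {Y : 𝒟} [R.Additive] (h : negOrth (R.obj Y) V) (adj : F ⊣ R) :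
    negOrth Y (F.obj V) :=
  fun n hn f => by
    apply (adj.homEquiv _ _).injective
    have := h n hn (adj.homEquiv _ _ f ≫ (R.commShiftIso (-n)).hom.app Y)
    rw [Preadditive.IsIso.comp_right_eq_zero] at this
    rw [this, Adjunction.homEquiv_unit, Functor.map_zero, comp_zero]

variable (adj : F ⊣ R)

lemma map_counit_naturality {X Y : 𝒟} (f : X ⟶ Y) :
    R.map (F.map (R.map f)) ≫ R.map (adj.counit.app Y) = R.map (adj.counit.app X) ≫ R.map f := by
  rw [← R.map_comp, ← R.map_comp]
  exact congrArg R.map (adj.counit.naturality f)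

variable {T : 𝒞}

variable (T) in
/-- The objects `Y` of `𝒟` whose image under `R` is at least as coconnective as `T`. -/
def RelCoconnective (R : 𝒟 ⥤ 𝒞) (Y : 𝒟) : Prop := negOrth T ≤ negOrth (R.obj Y)

/-- `f` is a morphism from the algebra `(T, m)` over the monad `F ⋙ R` to the algebra
on `R.obj Y` given by the counit. -/
def Equivariant (m : R.obj (F.obj T) ⟶ T) (Y : 𝒟) (f : T ⟶ R.obj Y) : Prop :=
  R.map (F.map f) ≫ R.map (adj.counit.app Y) = m ≫ f

/-- A stage of the tower converging to the lift of `(T, m)` to `𝒟`: an object `X` with an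
equivariant split epimorphism `r : R.obj X ⟶ T` through which each equivariant map out of `T`
extends to a unique map out of `X`. -/
structure Stage (m : R.obj (F.obj T) ⟶ T) (P : ObjectProperty 𝒟) where
  X : 𝒟
  prop : P X
  r : R.obj X ⟶ T
  s : T ⟶ R.obj X
  s_r : s ≫ r = 𝟙 T
  equivariant : R.map (adj.counit.app X) ≫ r = R.map (F.map r) ≫ m
  negOrth_obj : negOrth T (R.obj X)
  negOrth_of_rel : ∀ Y, RelCoconnective T R Y → negOrth Y X
  exists_lift : ∀ Y, RelCoconnective T R Y → ∀ f : T ⟶ R.obj Y, Equivariant adj m Y f →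
    ∃ g : X ⟶ Y, R.map g = r ≫ f
  eq_zero : ∀ Y, RelCoconnective T R Y → ∀ g : X ⟶ Y, R.map g = 0 → g = 0

variable {adj} {m : R.obj (F.obj T) ⟶ T} {P : ObjectProperty 𝒟}

/-- The first stage is the free object `F.obj T`. -/
def Stage.zero [R.Additive] (hm₁ : adj.unit.app T ≫ m = 𝟙 T)
    (hm₂ : R.map (adj.counit.app (F.obj T)) ≫ m = R.map (F.map m) ≫ m)
    (hT : negOrth T T) (hM : ∀ V Z : 𝒞, (∀ f : V ⟶ Z, f = 0) → ∀ f : R.obj (F.obj V) ⟶ Z, f = 0)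
    (hP : P (F.obj T)) : Stage adj m P where
  X := F.obj T
  prop := hP
  r := m
  s := adj.unit.app T
  s_r := hm₁
  equivariant := hm₂
  negOrth_obj n hn := hM _ _ (hT n hn)
  negOrth_of_rel Y hY := (hY _ hT).leftAdjoint adj
  exists_lift Y _ f hf := ⟨F.map f ≫ adj.counit.app Y, by rw [Functor.map_comp]; exact hf⟩
  eq_zero Y _ g hg := by
    apply (adj.homEquiv _ _).injective
    simp [Adjunction.homEquiv_unit, hg]

/-- The next stage is the cone of the map `F.obj K ⟶ X` adjoint to the kernel `i : K ⟶ R.obj X` of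
the split epimorphism `r`. The transition map of the tower factors through `T` after applying `R`,
since the composition of `i` with it vanishes. -/
lemma Stage.exists_next [F.CommShift ℤ] [F.IsTriangulated] [R.IsTriangulated]
    (hM : ∀ V Z : 𝒞, (∀ f : V ⟶ Z, f = 0) → ∀ f : R.obj (F.obj V) ⟶ Z, f = 0)
    (hP : ∀ (X : 𝒟) (r : R.obj X ⟶ T) (K : 𝒞) (i : K ⟶ R.obj X) (δ : T ⟶ K⟦(1 : ℤ)⟧),
      Triangle.mk i r δ ∈ distTriang 𝒞 → P X →
      ∀ (X' : 𝒟) (v : F.obj K ⟶ X) (j : X ⟶ X') (w : X' ⟶ (F.obj K)⟦(1 : ℤ)⟧),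
        Triangle.mk v j w ∈ distTriang 𝒟 → P X')
    (S : Stage adj m P) :
    ∃ (S' : Stage adj m P) (j : S.X ⟶ S'.X), R.map j = S.r ≫ S'.s := by
  obtain ⟨K, i, δ, hK⟩ := distinguished_cocone_triangle₁ S.r
  have hir : i ≫ S.r = 0 := comp_distTriang_mor_zero₁₂ _ hK
  -- `S.r` is a split epimorphism, so `i` is a split monomorphism
  have hδ : δ = 0 := by
    have h : S.r ≫ δ = 0 := comp_distTriang_mor_zero₂₃ _ hK
    rw [← Category.id_comp δ, ← S.s_r, Category.assoc, h, comp_zero]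
  have hi : Mono i := Triangle.mono₁ _ hK hδ
  have hKT : negOrth T K := by
    have := isSplitMono_of_mono i
    exact S.negOrth_obj.retract i (retraction i) (IsSplitMono.id i)
  let v : F.obj K ⟶ S.X := F.map i ≫ adj.counit.app S.X
  obtain ⟨X', j, w, hX'⟩ := distinguished_cocone_triangle v
  have hvj : v ≫ j = 0 := comp_distTriang_mor_zero₁₂ _ hX'
  have hRX' : Triangle.mk (R.map v) (R.map j) _ ∈ distTriang 𝒞 := R.map_distinguished _ hX'
  have hv : adj.unit.app K ≫ R.map v = i := by simp [v]
  have hvr : R.map v ≫ S.r = 0 := by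
    rw [R.map_comp, Category.assoc, S.equivariant, ← Category.assoc, ← R.map_comp, ← F.map_comp,
      hir]
    simp
  obtain ⟨r', hr'⟩ : ∃ r' : R.obj X' ⟶ T, S.r = R.map j ≫ r' :=
    exists_factor_of_distTriang hRX' S.r hvr
  have hij : i ≫ R.map j = 0 := by
    rw [← hv, Category.assoc, ← R.map_comp, hvj, R.map_zero, comp_zero]
  have hj : R.map j = S.r ≫ S.s ≫ R.map j := by
    obtain ⟨t, ht⟩ := exists_factor_of_distTriang hK _ hij
    rw [ht, reassoc_of% S.s_r]
  have hM' : ∀ V Z : 𝒞, negOrth Z V → negOrth Z (R.obj (F.obj V)) :=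
    fun V Z h n hn => hM _ _ (h n hn)
  have hMK : negOrth T (R.obj (F.obj K)) := hM' _ _ hKT
  have hMX' : Triangle.mk (R.map (F.map (R.map v))) (R.map (F.map (R.map j))) _ ∈ distTriang 𝒞 :=
    R.map_distinguished _ (F.map_distinguished _ hRX')
  refine ⟨⟨X', hP _ _ _ _ _ hK S.prop _ _ _ _ hX', r', S.s ≫ R.map j, ?_, ?_, ?_, ?_, ?_, ?_⟩,
    j, hj⟩
  · rw [Category.assoc, ← hr', S.s_r]
  · -- the two maps agree on `R.obj S.X`, and there are no maps out of the remaining part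
    refine eq_of_distTriang hMX' (hM' _ _ hMK).eq_zero_of_shift ?_
    rw [reassoc_of% (map_counit_naturality adj j), ← hr', S.equivariant, hr',
      F.map_comp, R.map_comp, Category.assoc]
  · exact negOrth.obj₃ hRX' hMK S.negOrth_obj
  · intro Y hY
    exact negOrth.obj₃ hX' ((hY _ hKT).leftAdjoint adj) (S.negOrth_of_rel Y hY)
  · intro Y hY f hf
    obtain ⟨g, hg⟩ := S.exists_lift Y hY f hf
    obtain ⟨g', hg'⟩ := exists_factor_of_distTriang hX' g (by
      apply (adj.homEquiv _ _).injective
      rw [Adjunction.homEquiv_unit, Adjunction.homEquiv_unit, R.map_comp, reassoc_of% hv, hg,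
        reassoc_of% hir, R.map_zero, zero_comp, comp_zero])
    refine ⟨g', eq_of_distTriang hRX' (hM' _ _ (hY _ hKT)).eq_zero_of_shift ?_⟩
    rw [← R.map_comp, ← hg', hg, ← Category.assoc, ← hr']
  · intro Y hY g hg
    refine eq_of_distTriang hX' ((hY _ hKT).leftAdjoint adj).eq_zero_of_shift ?_
    rw [comp_zero]
    refine S.eq_zero Y hY _ ?_
    rw [R.map_comp, hg, comp_zero]

/-- An algebra `(T, m)` over the monad of an adjunction `F ⊣ R` of triangulated functors lifts to
an object of `𝒟`, provided `T` has no negative self-extensions and the monad preserves the vanishing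
of maps to a given object. The lift has the universal property of `T` with respect to equivariant
maps to the objects of `𝒟` which are at least as coconnective as `T`. The property `P` serves to
keep track of the size of the lift: the assumptions on it are what the construction, the homotopy
colimit of an iteration of cones, uses. -/
theorem exists_universal_lift [F.CommShift ℤ] [F.IsTriangulated] [R.IsTriangulated]
    (hm₁ : adj.unit.app T ≫ m = 𝟙 T)
    (hm₂ : R.map (adj.counit.app (F.obj T)) ≫ m = R.map (F.map m) ≫ m)
    (hT : negOrth T T)
    (hM : ∀ V Z : 𝒞, (∀ f : V ⟶ Z, f = 0) → ∀ f : R.obj (F.obj V) ⟶ Z, f = 0)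
    (hP₀ : P (F.obj T))
    (hP : ∀ (X : 𝒟) (r : R.obj X ⟶ T) (K : 𝒞) (i : K ⟶ R.obj X) (δ : T ⟶ K⟦(1 : ℤ)⟧),
      Triangle.mk i r δ ∈ distTriang 𝒞 → P X →
      ∀ (X' : 𝒟) (v : F.obj K ⟶ X) (j : X ⟶ X') (w : X' ⟶ (F.obj K)⟦(1 : ℤ)⟧),
        Triangle.mk v j w ∈ distTriang 𝒟 → P X')
    (hPcone : ∀ Δ ∈ distTriang 𝒟, P Δ.obj₁ → P Δ.obj₂ → P Δ.obj₃)
    (hPcoprod : ∀ X : ℕ → 𝒟, (∀ n, P (X n)) → ∃ c : Cofan X, P c.pt ∧ Nonempty (IsColimit c) ∧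
      Nonempty (IsColimit (Cofan.mk (R.obj c.pt) fun n => R.map (c.inj n)))) :
    ∃ (X : 𝒟) (e : T ≅ R.obj X), P X ∧ Equivariant adj m X e.hom ∧
      (∀ Y, RelCoconnective T R Y → ∀ f : T ⟶ R.obj Y, Equivariant adj m Y f →
        ∃ g : X ⟶ Y, e.hom ≫ R.map g = f) ∧
      ∀ Y, RelCoconnective T R Y → ∀ g : X ⟶ Y, R.map g = 0 → g = 0 := by
  choose next trans htrans using Stage.exists_next (adj := adj) (m := m) (P := P) hM hP
  let S : ℕ → Stage adj m P := fun n => Nat.rec (Stage.zero hm₁ hm₂ hT hM hP₀) (fun _ => next) n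
  let j : ∀ n, (S n).X ⟶ (S (n + 1)).X := fun n => trans (S n)
  have hj : ∀ n, R.map (j n) = (S n).r ≫ (S (n + 1)).s := fun n => htrans (S n)
  have hjr : ∀ n, R.map (j n) ≫ (S (n + 1)).r = (S n).r := fun n => by
    rw [hj, Category.assoc, (S (n + 1)).s_r, Category.comp_id]
  have hsj : ∀ n, (S n).s ≫ R.map (j n) = (S (n + 1)).s := fun n => by
    rw [hj, reassoc_of% (S n).s_r]
  -- the homotopy colimit of the tower is the cone of `σ`, the identity minus the shift map
  obtain ⟨c, hPc, ⟨hc⟩, ⟨hRc⟩⟩ := hPcoprod (fun n => (S n).X) (fun n => (S n).prop)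
  let σ : c.pt ⟶ c.pt := Cofan.IsColimit.desc hc fun n => c.inj n - j n ≫ c.inj (n + 1)
  have hσ : ∀ n, c.inj n ≫ σ = c.inj n - j n ≫ c.inj (n + 1) := fun n =>
    Cofan.IsColimit.fac hc _ n
  have hRσ : ∀ n, R.map (c.inj n) ≫ R.map σ =
      R.map (c.inj n) - R.map (j n) ≫ R.map (c.inj (n + 1)) := fun n => by
    rw [← R.map_comp, hσ, R.map_sub, R.map_comp]
  have hext : ∀ {Z : 𝒞} (f g : R.obj c.pt ⟶ Z),
      (∀ n, R.map (c.inj n) ≫ f = R.map (c.inj n) ≫ g) → f = g := fun f g h =>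
    Cofan.IsColimit.hom_ext hRc _ _ h
  have hdesc : ∀ {Z : 𝒞} (f : ∀ n, R.obj (S n).X ⟶ Z),
      ∃ g : R.obj c.pt ⟶ Z, ∀ n, R.map (c.inj n) ≫ g = f n := fun f =>
    ⟨Cofan.IsColimit.desc hRc f, fun n => Cofan.IsColimit.fac hRc f n⟩
  obtain ⟨X, q, w, hX⟩ := distinguished_cocone_triangle σ
  have hRX : Triangle.mk (R.map σ) (R.map q) _ ∈ distTriang 𝒞 := R.map_distinguished _ hX
  -- `R.map σ` is a split monomorphism: its retraction solves a recursion along the tower, whose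
  -- transition maps factor through `T`
  obtain ⟨t, ht⟩ : ∃ t : R.obj c.pt ⟶ R.obj c.pt, R.map σ ≫ t = 𝟙 _ := by
    obtain ⟨d, hd⟩ : ∃ d : ℕ → (T ⟶ R.obj c.pt),
        ∀ n, d (n + 1) = d n - (S n).s ≫ R.map (c.inj n) :=
      ⟨fun n => Nat.rec 0 (fun n x => x - (S n).s ≫ R.map (c.inj n)) n, fun _ => rfl⟩
    obtain ⟨t, ht⟩ := hdesc fun n => R.map (c.inj n) + (S n).r ≫ d (n + 1)
    refine ⟨t, hext _ _ fun n => ?_⟩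
    rw [reassoc_of% (hRσ n), Preadditive.sub_comp, ht, Category.assoc, ht, Category.comp_id, hj,
      Category.assoc, Preadditive.comp_add, reassoc_of% (S (n + 1)).s_r, hd (n + 1),
      Preadditive.comp_add, Preadditive.comp_sub]
    abel
  -- hence morphisms out of `R.obj X` are determined by their restrictions to the stages
  have hq : Epi (R.map q) := by
    have : Mono (R.map σ) := ⟨fun a b h => by
      rw [← Category.comp_id a, ← ht, reassoc_of% h, ht, Category.comp_id]⟩
    exact Triangle.epi₂ _ hRX (Triangle.mor₃_eq_zero_of_mono₁ _ hRX this)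
  have hσq : σ ≫ q = 0 := comp_distTriang_mor_zero₁₂ _ hX
  have hjq : ∀ n, j n ≫ c.inj (n + 1) ≫ q = c.inj n ≫ q := fun n => by
    have := hσ n =≫ q
    rw [Category.assoc, hσq, comp_zero, Preadditive.sub_comp, Category.assoc] at this
    exact (sub_eq_zero.1 this.symm).symm
  let φ : T ⟶ R.obj X := (S 0).s ≫ R.map (c.inj 0 ≫ q)
  have hφ : ∀ n, (S n).s ≫ R.map (c.inj n ≫ q) = φ := fun n => by
    induction n with
    | zero => rfl
    | succ n ih => rw [← ih, ← hsj, Category.assoc, ← R.map_comp, hjq]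
  have hqφ : ∀ n, R.map (c.inj n ≫ q) = (S n).r ≫ φ := fun n => by
    rw [← hφ (n + 1), ← hjq, R.map_comp, hj, Category.assoc]
  obtain ⟨ρ₀, hρ₀⟩ := hdesc fun n => (S n).r
  obtain ⟨ρ, hρ⟩ := exists_factor_of_distTriang hRX ρ₀ (hext _ _ fun n => by
    rw [reassoc_of% (hRσ n), Preadditive.sub_comp, Category.assoc, hρ₀, hρ₀, hjr, sub_self,
      comp_zero])
  have hqρ : ∀ n, R.map (c.inj n ≫ q) ≫ ρ = (S n).r := fun n => by
    rw [R.map_comp, Category.assoc, ← hρ, hρ₀]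
  let e : T ≅ R.obj X := ⟨φ, ρ, by rw [← hφ 0, Category.assoc, hqρ, (S 0).s_r], by
    rw [← cancel_epi (R.map q)]
    refine hext _ _ fun n => ?_
    rw [Category.comp_id, ← R.map_comp, ← R.map_comp_assoc, ← Category.assoc, hqρ, hqφ]⟩
  refine ⟨X, e, hPcone _ hX hPc hPc, ?_, ?_, ?_⟩
  · change R.map (F.map φ) ≫ R.map (adj.counit.app X) = m ≫ φ
    have hs : R.map (F.map (S 0).s) ≫ R.map (F.map (S 0).r) = 𝟙 _ := by
      rw [← R.map_comp, ← F.map_comp, (S 0).s_r, F.map_id, R.map_id]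
    have hr : R.map (F.map (S 0).r) ≫ R.map (F.map φ) ≫ R.map (adj.counit.app X) =
        R.map (F.map (S 0).r) ≫ m ≫ φ := by
      rw [← reassoc_of% (S 0).equivariant, ← hqφ, ← map_counit_naturality, hqφ,
        F.map_comp (S 0).r φ, R.map_comp (F.map (S 0).r), Category.assoc]
    simpa [reassoc_of% hs] using R.map (F.map (S 0).s) ≫= hr
  · intro Y hY f hf
    choose g hg using fun n => (S n).exists_lift Y hY f hf
    have hjg : ∀ n, j n ≫ g (n + 1) = g n := fun n => by
      refine sub_eq_zero.1 ((S n).eq_zero Y hY _ ?_)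
      rw [R.map_sub, R.map_comp, hg, hg, reassoc_of% (hjr n), sub_self]
    obtain ⟨g', hg'⟩ := exists_factor_of_distTriang hX (Cofan.IsColimit.desc hc g)
      (Cofan.IsColimit.hom_ext hc _ _ fun n => by
        rw [reassoc_of% (hσ n), Preadditive.sub_comp, Category.assoc, Cofan.IsColimit.fac,
          Cofan.IsColimit.fac, hjg, sub_self, comp_zero])
    refine ⟨g', ?_⟩
    change φ ≫ _ = _
    rw [← hφ 0, Category.assoc, ← R.map_comp, Category.assoc, ← hg', Cofan.IsColimit.fac, hg,
      reassoc_of% (S 0).s_r]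
  · intro Y hY g hg
    refine eq_of_distTriang hX
      (negOrth.cofan hc fun n => (S n).negOrth_of_rel Y hY).eq_zero_of_shift ?_
    refine Cofan.IsColimit.hom_ext hc _ _ fun n => ?_
    rw [comp_zero, comp_zero]
    refine (S n).eq_zero Y hY _ ?_
    rw [R.map_comp, R.map_comp, hg, comp_zero, comp_zero]

end Triangulated

/-! ### Free bimodules -/

section FreeBimodule

variable (k A B : Type u) [CommRing k] [Ring A] [Algebra k A] [Ring B] [Algebra k B]

variable {B}

lemma rTensor_lTensor_commute (V : RightMod B) (a : A) (b : Bᵐᵒᵖ) :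
    Commute ((Module.End.rTensorAlgHom k A V).comp (Algebra.lmul k A) a)
      ((Module.End.lTensorAlgHom k V A).comp (Algebra.lsmul k k V) b) := by
  refine TensorProduct.ext' fun x v => ?_
  rfl

/-- The action of `A ⊗ Bᵐᵒᵖ` on `A ⊗ V`, for a right `B`-module `V`. -/
noncomputable def tensorAction (V : RightMod B) :
    A ⊗[k] Bᵐᵒᵖ →ₐ[k] Module.End k (A ⊗[k] V) :=
  Algebra.TensorProduct.lift _ _ (rTensor_lTensor_commute k A V)

lemma tensorAction_tmul (V : RightMod B) (a x : A) (b : Bᵐᵒᵖ) (v : V) :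
    tensorAction k A V (a ⊗ₜ b) (x ⊗ₜ v) = (a * x) ⊗ₜ (b • v) :=
  LinearMap.congr_fun
    (Algebra.TensorProduct.lift_tmul _ _ (rTensor_lTensor_commute k A V) a b) (x ⊗ₜ[k] v)

/-- The `A`-`B`-bimodule `A ⊗ V` freely generated by a right `B`-module `V`. -/
noncomputable def freeBimod (V : RightMod B) : BimodCat k A B :=
  letI : Module (A ⊗[k] Bᵐᵒᵖ) (A ⊗[k] V) := Module.compHom _ (tensorAction k A V).toRingHom
  ModuleCat.of (A ⊗[k] Bᵐᵒᵖ) (A ⊗[k] V)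

variable {k A}

/-- The pure tensors in the free bimodule `A ⊗ V`. -/
noncomputable def pureTensor {V : RightMod B} (a : A) (v : V) : freeBimod k A V :=
  (a ⊗ₜ[k] v : A ⊗[k] V)

section

variable {V : RightMod B}

lemma smul_pureTensor (a x : A) (b : Bᵐᵒᵖ) (v : V) :
    ((a ⊗ₜ[k] b : A ⊗[k] Bᵐᵒᵖ) • (pureTensor x v : freeBimod k A V) : freeBimod k A V) =
      pureTensor (a * x) (b • v) :=
  tensorAction_tmul k A V a x b v

lemma pureTensor_add (a : A) (v w : V) :
    (pureTensor a (v + w) : freeBimod k A V) = pureTensor a v + pureTensor a w :=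
  TensorProduct.tmul_add _ _ _

lemma add_pureTensor (a b : A) (v : V) :
    (pureTensor (a + b) v : freeBimod k A V) = pureTensor a v + pureTensor b v :=
  TensorProduct.add_tmul _ _ _

lemma smul_pureTensor_comm (c : k) (a : A) (v : V) :
    (pureTensor (c • a) v : freeBimod k A V) = pureTensor a (c • v) :=
  TensorProduct.smul_tmul _ _ _

@[elab_as_elim]
lemma freeBimod_induction {p : freeBimod k A V → Prop} (x : freeBimod k A V) (zero : p 0)
    (pure : ∀ a v, p (pureTensor a v)) (add : ∀ x y, p x → p y → p (x + y)) : p x :=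
  TensorProduct.induction_on (motive := p) (x : A ⊗[k] V) zero pure add

/-- The additive map out of `A ⊗ V` given by a balanced biadditive map. -/
noncomputable def balancedLift {N : Type*} [AddCommGroup N] (f : A → V → N)
    (h₁ : ∀ a b v, f (a + b) v = f a v + f b v) (h₂ : ∀ a v w, f a (v + w) = f a v + f a w)
    (h₃ : ∀ (c : k) (a : A) (v : V), f (c • a) v = f a (c • v)) : freeBimod k A V →+ N :=
  TensorProduct.liftAddHom
    (AddMonoidHom.mk' (fun a => AddMonoidHom.mk' (f a) (h₂ a)) fun a b =>
      AddMonoidHom.ext (h₁ a b)) h₃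

lemma balancedLift_pureTensor {N : Type*} [AddCommGroup N] (f : A → V → N)
    (h₁ : ∀ a b v, f (a + b) v = f a v + f b v) (h₂ : ∀ a v w, f a (v + w) = f a v + f a w)
    (h₃ : ∀ (c : k) (a : A) (v : V), f (c • a) v = f a (c • v)) (a : A) (v : V) :
    balancedLift f h₁ h₂ h₃ (pureTensor a v) = f a v :=
  TensorProduct.liftAddHom_tmul _ _ _ _

/-- An additive map out of `A ⊗ V` is a map of bimodules if it is so on pure tensors. -/
noncomputable def freeBimodLinearMap {Y : BimodCat k A B} (f : freeBimod k A V →+ Y)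
    (hf : ∀ (a x : A) (b : Bᵐᵒᵖ) (v : V), f (pureTensor (a * x) (b • v)) =
      ((a ⊗ₜ[k] b : A ⊗[k] Bᵐᵒᵖ) • f (pureTensor x v) : Y)) :
    freeBimod k A V →ₗ[A ⊗[k] Bᵐᵒᵖ] Y where
  toFun := f
  map_add' := map_add f
  map_smul' := fun r x => by
    rw [RingHom.id_apply]
    induction r with
    | zero =>
      exact (congrArg f (zero_smul (A ⊗[k] Bᵐᵒᵖ) x)).trans
        ((map_zero f).trans (zero_smul (A ⊗[k] Bᵐᵒᵖ) (f x)).symm)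
    | add r s hr hs => rw [add_smul, add_smul, map_add, hr, hs]
    | tmul a b =>
      induction x using freeBimod_induction with
      | zero => rw [smul_zero, map_zero, smul_zero]
      | add x y hx hy => rw [smul_add, map_add, map_add, smul_add, hx, hy]
      | pure x v => rw [smul_pureTensor, hf]

/-- The map of bimodules out of `A ⊗ V` given by an additive map, see `freeBimodLinearMap`. -/
noncomputable def freeBimodHom {Y : BimodCat k A B} (f : freeBimod k A V →+ Y)
    (hf : ∀ (a x : A) (b : Bᵐᵒᵖ) (v : V), f (pureTensor (a * x) (b • v)) =
      ((a ⊗ₜ[k] b : A ⊗[k] Bᵐᵒᵖ) • f (pureTensor x v) : Y)) : freeBimod k A V ⟶ Y :=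
  let g := ModuleCat.ofHom (freeBimodLinearMap f hf)
  g

lemma freeBimod_hom_ext {Y : BimodCat k A B} {f g : freeBimod k A V ⟶ Y}
    (h : ∀ (a : A) (v : V), f.hom (pureTensor a v) = g.hom (pureTensor a v)) : f = g :=
  ModuleCat.hom_ext (LinearMap.ext fun x => by
    induction x using freeBimod_induction with
    | zero => rw [map_zero, map_zero]
    | add x y hx hy => rw [map_add, map_add, hx, hy]
    | pure a v => exact h a v)

variable (k) in
/-- The `B`-linear map `V ⟶ A ⊗ V` sending `v` to `a ⊗ v`. -/
noncomputable def incl (a : A) (V : RightMod B) : V ⟶ (restrictRight k A B).obj (freeBimod k A V) :=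
  ModuleCat.ofHom (Y := (restrictRight k A B).obj (freeBimod k A V))
    { toFun := fun v => (pureTensor a v : freeBimod k A V)
      map_add' := pureTensor_add a
      map_smul' := fun b v => by
        change _ = ((1 : A) ⊗ₜ[k] b : A ⊗[k] Bᵐᵒᵖ) • (pureTensor a v : freeBimod k A V)
        rw [smul_pureTensor, one_mul] }

lemma incl_add (a b : A) : incl k (a + b) V = incl k a V + incl k b V :=
  ModuleCat.hom_ext (LinearMap.ext (add_pureTensor a b))

lemma incl_smul (c : k) (a : A) : incl k (c • a) V = c • incl k a V := by
  refine ModuleCat.hom_ext (LinearMap.ext fun v => ?_)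
  refine (smul_pureTensor_comm c a v).trans ?_
  refine (congrArg (pureTensor a) (algebraMap_smul Bᵐᵒᵖ c v).symm).trans ?_
  exact (incl k a V).hom.map_smul _ _

lemma restrict_freeBimod_hom_ext {N : RightMod B}
    {f g : (restrictRight k A B).obj (freeBimod k A V) ⟶ N}
    (h : ∀ a : A, incl k a V ≫ f = incl k a V ≫ g) : f = g :=
  ModuleCat.hom_ext (LinearMap.ext fun (x : freeBimod k A V) => by
    induction x using freeBimod_induction with
    | zero => exact (map_zero f.hom).trans (map_zero g.hom).symm
    | add x y hx hy =>
      exact (map_add f.hom _ _).trans ((congrArg₂ (· + ·) hx hy).trans (map_add g.hom _ _).symm)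
    | pure a v => exact congrArg (fun φ : V ⟶ N => φ.hom v) (h a))

/-- The additive map underlying `tensorDesc`. -/
noncomputable def tensorDescAddHom {N : RightMod B} (h : A →ₗ[k] (V ⟶ N)) :
    freeBimod k A V →+ N :=
  balancedLift (fun a v => (h a).hom v)
    (fun a b v => by rw [map_add]; rfl) (fun a v w => map_add _ _ _) (fun c a v => by
      rw [map_smul, ← algebraMap_smul Bᵐᵒᵖ c v, map_smul, algebraMap_smul]
      rfl)

lemma tensorDescAddHom_pureTensor {N : RightMod B} (h : A →ₗ[k] (V ⟶ N)) (a : A) (v : V) :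
    tensorDescAddHom h (pureTensor a v) = (h a).hom v :=
  balancedLift_pureTensor _ _ _ _ a v

/-- The `B`-linear map `A ⊗ V ⟶ N` given by a `k`-linear family of `B`-linear maps `V ⟶ N`. -/
noncomputable def tensorDesc {N : RightMod B} (h : A →ₗ[k] (V ⟶ N)) :
    (restrictRight k A B).obj (freeBimod k A V) ⟶ N :=
  ModuleCat.ofHom (X := (restrictRight k A B).obj (freeBimod k A V))
    { toFun := tensorDescAddHom h
      map_add' := map_add (tensorDescAddHom h)
      map_smul' := fun b (x : freeBimod k A V) => by
        change tensorDescAddHom h (((1 : A) ⊗ₜ[k] b : A ⊗[k] Bᵐᵒᵖ) • x) = b • tensorDescAddHom h x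
        induction x using freeBimod_induction with
        | zero => rw [smul_zero, map_zero, smul_zero]
        | add x y hx hy => rw [smul_add, map_add, map_add, smul_add, hx, hy]
        | pure x v =>
          rw [smul_pureTensor, one_mul, tensorDescAddHom_pureTensor, tensorDescAddHom_pureTensor]
          exact (h x).hom.map_smul b v }

lemma incl_tensorDesc {N : RightMod B} (h : A →ₗ[k] (V ⟶ N)) (a : A) :
    incl k a V ≫ tensorDesc h = h a :=
  ModuleCat.hom_ext (LinearMap.ext fun v => tensorDescAddHom_pureTensor h a v)

end

/-- The additive map underlying `freeMap`. -/
noncomputable def freeMapAddHom {V W : RightMod B} (f : V ⟶ W) :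
    freeBimod k A V →+ freeBimod k A W :=
  balancedLift (fun a v => pureTensor a (f.hom v))
    (fun a b v => add_pureTensor a b _) (fun a v w => by rw [map_add, pureTensor_add])
    (fun c a v => by
      rw [smul_pureTensor_comm, ← algebraMap_smul Bᵐᵒᵖ c v, map_smul, algebraMap_smul])

lemma freeMapAddHom_pureTensor {V W : RightMod B} (f : V ⟶ W) (a : A) (v : V) :
    freeMapAddHom f (pureTensor a v : freeBimod k A V) = pureTensor a (f.hom v) :=
  balancedLift_pureTensor _ _ _ _ a v

/-- The map of bimodules `A ⊗ V ⟶ A ⊗ W` induced by `V ⟶ W`. -/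
noncomputable def freeMap {V W : RightMod B} (f : V ⟶ W) : freeBimod k A V ⟶ freeBimod k A W :=
  freeBimodHom (freeMapAddHom f) (fun a x b v => by
    rw [freeMapAddHom_pureTensor, freeMapAddHom_pureTensor, smul_pureTensor, map_smul])

lemma freeMap_pureTensor {V W : RightMod B} (f : V ⟶ W) (a : A) (v : V) :
    (freeMap f).hom (pureTensor a v : freeBimod k A V) = pureTensor a (f.hom v) :=
  freeMapAddHom_pureTensor f a v

/-- The functor `V ↦ A ⊗ V` from right `B`-modules to bimodules. -/
noncomputable def freeFunctor : RightMod B ⥤ BimodCat k A B where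
  obj V := freeBimod k A V
  map f := freeMap f
  map_id V := freeBimod_hom_ext fun a v => freeMap_pureTensor _ a v
  map_comp f g := freeBimod_hom_ext fun a v => by
    rw [ModuleCat.comp_apply, freeMap_pureTensor, freeMap_pureTensor, freeMap_pureTensor,
      ModuleCat.comp_apply]

instance : (freeFunctor (k := k) (A := A) (B := B)).Additive where
  map_add {V W f g} := freeBimod_hom_ext fun a v => by
    refine (freeMap_pureTensor (f + g) a v).trans ((pureTensor_add a _ _).trans ?_)
    exact congrArg₂ (· + ·) (freeMap_pureTensor f a v).symm (freeMap_pureTensor g a v).symm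

lemma incl_freeMap {V W : RightMod B} (f : V ⟶ W) (a : A) :
    incl k a V ≫ (restrictRight k A B).map (freeMap f) = f ≫ incl k a W :=
  ModuleCat.hom_ext (LinearMap.ext fun v => freeMap_pureTensor f a v)

/-- The additive map underlying `actionMap`. -/
noncomputable def actionAddHom (Y : BimodCat k A B) :
    freeBimod k A ((restrictRight k A B).obj Y) →+ Y :=
  balancedLift (V := (restrictRight k A B).obj Y) (N := Y)
    (fun a y => (a ⊗ₜ[k] (1 : Bᵐᵒᵖ) : A ⊗[k] Bᵐᵒᵖ) • (show Y from y))
    (fun a b y => by rw [TensorProduct.add_tmul]; exact add_smul _ _ (show Y from y))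
    (fun a y z => smul_add (a ⊗ₜ[k] (1 : Bᵐᵒᵖ)) (show Y from y) (show Y from z))
    (fun c a y => by
      change ((c • a) ⊗ₜ[k] (1 : Bᵐᵒᵖ) : A ⊗[k] Bᵐᵒᵖ) • (y : Y) =
        (a ⊗ₜ[k] (1 : Bᵐᵒᵖ) : A ⊗[k] Bᵐᵒᵖ) •
          (((1 : A) ⊗ₜ[k] (algebraMap k Bᵐᵒᵖ c) : A ⊗[k] Bᵐᵒᵖ) • (y : Y))
      rw [← mul_smul, Algebra.TensorProduct.tmul_mul_tmul, mul_one, one_mul,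
        Algebra.algebraMap_eq_smul_one, TensorProduct.smul_tmul])

lemma actionAddHom_pureTensor (Y : BimodCat k A B) (a : A) (y : (restrictRight k A B).obj Y) :
    actionAddHom Y (pureTensor a y) =
      ((a ⊗ₜ[k] (1 : Bᵐᵒᵖ) : A ⊗[k] Bᵐᵒᵖ) • (show Y from y) : Y) :=
  balancedLift_pureTensor _ _ _ _ a y

/-- The action map `A ⊗ Y ⟶ Y` of a bimodule `Y`. -/
noncomputable def actionMap (Y : BimodCat k A B) :
    freeBimod k A ((restrictRight k A B).obj Y) ⟶ Y :=
  freeBimodHom (actionAddHom Y) (fun a x b y => by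
    rw [actionAddHom_pureTensor, actionAddHom_pureTensor]
    change ((a * x) ⊗ₜ[k] (1 : Bᵐᵒᵖ) : A ⊗[k] Bᵐᵒᵖ) •
      (((1 : A) ⊗ₜ[k] b : A ⊗[k] Bᵐᵒᵖ) • (y : Y)) = (a ⊗ₜ[k] b : A ⊗[k] Bᵐᵒᵖ) •
        ((x ⊗ₜ[k] (1 : Bᵐᵒᵖ) : A ⊗[k] Bᵐᵒᵖ) • (y : Y))
    rw [← mul_smul, ← mul_smul]
    simp)

lemma actionMap_pureTensor (Y : BimodCat k A B) (a : A) (y : (restrictRight k A B).obj Y) :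
    (actionMap Y).hom (pureTensor a y) =
      ((a ⊗ₜ[k] (1 : Bᵐᵒᵖ) : A ⊗[k] Bᵐᵒᵖ) • (show Y from y) : Y) :=
  actionAddHom_pureTensor Y a y

lemma incl_actionMap (Y : BimodCat k A B) (a : A) :
    incl k a _ ≫ (restrictRight k A B).map (actionMap Y) = leftMulLinear Y a :=
  ModuleCat.hom_ext (LinearMap.ext fun y => actionMap_pureTensor Y a y)

/-- The functor `V ↦ A ⊗ V` is left adjoint to the restriction functor. -/
noncomputable def freeAdjunction :
    freeFunctor (k := k) (A := A) (B := B) ⊣ restrictRight k A B :=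
  Adjunction.mkOfUnitCounit (F := freeFunctor (k := k) (A := A) (B := B))
   (G := restrictRight k A B)
    { unit :=
        { app := fun V => incl k (1 : A) V
          naturality := fun V W f => (incl_freeMap f (1 : A)).symm }
      counit :=
        { app := fun Y => actionMap Y
          naturality := fun X Y f => freeBimod_hom_ext fun a x => by
            refine (congrArg (actionMap Y).hom
              (freeMap_pureTensor ((restrictRight k A B).map f) a x)).trans ?_
            refine (actionMap_pureTensor Y a _).trans ?_
            refine Eq.trans ?_ (congrArg f.hom (actionMap_pureTensor X a x)).symm
            exact (f.hom.map_smul _ _).symm }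
      left_triangle := by
        ext V : 2
        refine freeBimod_hom_ext fun a v => ?_
        refine (congrArg (actionMap (freeBimod k A V)).hom
          (freeMap_pureTensor (incl k (1 : A) V) a v)).trans ?_
        refine (actionMap_pureTensor _ a _).trans ?_
        refine (smul_pureTensor a 1 1 v).trans ?_
        rw [mul_one, one_smul]
        rfl
      right_triangle := by
        ext Y : 2
        change incl k (1 : A) _ ≫ 𝟙 _ ≫ (restrictRight k A B).map (actionMap Y) = 𝟙 _
        rw [Category.id_comp, incl_actionMap]
        refine ModuleCat.hom_ext (LinearMap.ext fun (y : Y) => ?_)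
        exact one_smul (A ⊗[k] Bᵐᵒᵖ) y }

end FreeBimodule

/-! ### Free complexes of bimodules and the induced adjunction on homotopy categories -/

section AdjunctionOnHomotopyCategories

variable {V W : Type*} [Category* V] [Preadditive V] [Category* W] [Preadditive W]
  {F : V ⥤ W} {G : W ⥤ V} [F.Additive] [G.Additive]

/-- An adjunction between additive functors induces an adjunction between the functors induced
on homotopy categories. -/
noncomputable def adjunctionMapHomotopyCategory (adj : F ⊣ G) {ι : Type*} (c : ComplexShape ι) :
    F.mapHomotopyCategory c ⊣ G.mapHomotopyCategory c :=
  Adjunction.mkOfUnitCounit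
    { unit :=
        { app := fun K => (HomotopyCategory.quotient V c).map
            ({ f := fun i => adj.unit.app (K.as.X i),
               comm' := fun i j _ => (adj.unit.naturality (K.as.d i j)).symm } :
              K.as ⟶ (G.mapHomologicalComplex c).obj ((F.mapHomologicalComplex c).obj K.as))
          naturality := by
            rintro ⟨K⟩ ⟨L⟩ ⟨f : K ⟶ L⟩
            refine congrArg (HomotopyCategory.quotient V c).map (HomologicalComplex.hom_ext _ _
              fun i => adj.unit.naturality (f.f i)) }
      counit :=
        { app := fun K => (HomotopyCategory.quotient W c).map
            ({ f := fun i => adj.counit.app (K.as.X i),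
               comm' := fun i j _ => (adj.counit.naturality (K.as.d i j)).symm } :
              (F.mapHomologicalComplex c).obj ((G.mapHomologicalComplex c).obj K.as) ⟶ K.as)
          naturality := by
            rintro ⟨K⟩ ⟨L⟩ ⟨f : K ⟶ L⟩
            refine congrArg (HomotopyCategory.quotient W c).map (HomologicalComplex.hom_ext _ _
              fun i => adj.counit.naturality (f.f i)) }
      left_triangle := by
        ext K : 2
        refine Eq.trans (b := (HomotopyCategory.quotient W c).map (𝟙
          ((F.mapHomologicalComplex c).obj K.as))) ?_ (CategoryTheory.Functor.map_id _ _)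
        change (HomotopyCategory.quotient W c).map _ ≫ 𝟙 _ ≫
          (HomotopyCategory.quotient W c).map _ = _
        rw [Category.id_comp]
        exact congrArg (HomotopyCategory.quotient W c).map (HomologicalComplex.hom_ext _ _
          fun i => adj.left_triangle_components (K.as.X i))
      right_triangle := by
        ext K : 2
        refine Eq.trans (b := (HomotopyCategory.quotient V c).map (𝟙
          ((G.mapHomologicalComplex c).obj K.as))) ?_ (CategoryTheory.Functor.map_id _ _)
        change (HomotopyCategory.quotient V c).map _ ≫ 𝟙 _ ≫
          (HomotopyCategory.quotient V c).map _ = _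
        rw [Category.id_comp]
        exact congrArg (HomotopyCategory.quotient V c).map (HomologicalComplex.hom_ext _ _
          fun i => adj.right_triangle_components (K.as.X i)) }

end AdjunctionOnHomotopyCategories

section FreeComplex

variable (k A B : Type u) [CommRing k] [Ring A] [Algebra k A] [Ring B] [Algebra k B]

/-- The homotopy category of complexes of `A`-`B`-bimodules. -/
abbrev HtpyBimod := HomotopyCategory (BimodCat k A B) (ComplexShape.up ℤ)

/-- The functor `V ↦ A ⊗ V` on complexes. -/
noncomputable abbrev freeComplex :
    CochainComplex (RightMod B) ℤ ⥤ CochainComplex (BimodCat k A B) ℤ :=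
  freeFunctor.mapHomologicalComplex (ComplexShape.up ℤ)

/-- The functor `V ↦ A ⊗ V` on homotopy categories. -/
noncomputable abbrev freeHtpy : HtpyCat B ⥤ HtpyBimod k A B :=
  freeFunctor.mapHomotopyCategory (ComplexShape.up ℤ)

/-- The restriction functor on homotopy categories. -/
noncomputable abbrev resHtpy : HtpyBimod k A B ⥤ HtpyCat B :=
  (restrictRight k A B).mapHomotopyCategory (ComplexShape.up ℤ)

/-- `V ↦ A ⊗ V` is left adjoint to the restriction functor on homotopy categories. -/
noncomputable def htpyAdjunction : freeHtpy k A B ⊣ resHtpy k A B :=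
  adjunctionMapHomotopyCategory freeAdjunction _

variable {k A B}

/-- The map of complexes `V ⟶ A ⊗ V` sending `v` to `a ⊗ v`. -/
noncomputable def inclComplex (a : A) (V : CochainComplex (RightMod B) ℤ) :
    V ⟶ (resComplex k A B).obj ((freeComplex k A B).obj V) where
  f i := incl k a (V.X i)
  comm' i j _ := incl_freeMap (V.d i j) a

/-- The homotopy class of the inclusion `V ⟶ A ⊗ V`, `v ↦ a ⊗ v`. -/
noncomputable def inclHtpy (a : A) (V : HtpyCat B) :
    V ⟶ (resHtpy k A B).obj ((freeHtpy k A B).obj V) :=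
  (toHtpy B).map (inclComplex a V.as)

lemma inclHtpy_naturality (a : A) {V W : HtpyCat B} (f : V ⟶ W) :
    inclHtpy a V ≫ (resHtpy k A B).map ((freeHtpy k A B).map f) = f ≫ inclHtpy a W := by
  revert V W f
  rintro ⟨V⟩ ⟨W⟩ ⟨f : V ⟶ W⟩
  exact congrArg (toHtpy B).map (HomologicalComplex.hom_ext _ _
    fun i => incl_freeMap (f.f i) a)

lemma inclHtpy_counit (a : A) (Y : CochainComplex (BimodCat k A B) ℤ) :
    inclHtpy a _ ≫ (resHtpy k A B).map
      ((htpyAdjunction k A B).counit.app ((HomotopyCategory.quotient _ _).obj Y)) =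
    (toHtpy B).map (leftMul Y a) :=
  congrArg (toHtpy B).map (HomologicalComplex.hom_ext _ _ fun i => incl_actionMap (Y.X i) a)

lemma inclComplex_leftMul (a b : A) (V : CochainComplex (RightMod B) ℤ) :
    inclComplex b V ≫ leftMul ((freeComplex k A B).obj V) a = inclComplex (a * b) V :=
  HomologicalComplex.hom_ext _ _ fun i => ModuleCat.hom_ext (LinearMap.ext fun v =>
    (smul_pureTensor a b 1 v).trans (by rw [one_smul]; rfl))

variable (k) in
/-- The inclusions `V ⟶ A ⊗ V` depend `k`-linearly on `a`. -/
noncomputable def inclLinear (V : RightMod B) :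
    A →ₗ[k] (V ⟶ (restrictRight k A B).obj (freeBimod k A V)) where
  toFun a := incl k a V
  map_add' a b := incl_add a b
  map_smul' c a := incl_smul c a

/-- The components in degree `i` of a `k`-linear family of maps of complexes. -/
def componentLinear {V Z : CochainComplex (RightMod B) ℤ} (h : A →ₗ[k] (V ⟶ Z))
    (i : ℤ) : A →ₗ[k] (V.X i ⟶ Z.X i) where
  toFun a := (h a).f i
  map_add' a b := by rw [map_add]; rfl
  map_smul' c a := by rw [map_smul]; rfl

/-- The map `A ⊗ V ⟶ Z` given by a `k`-linear family of maps of complexes `V ⟶ Z`. -/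
noncomputable def descComplex {V Z : CochainComplex (RightMod B) ℤ} (h : A →ₗ[k] (V ⟶ Z)) :
    (resComplex k A B).obj ((freeComplex k A B).obj V) ⟶ Z where
  f i := tensorDesc (componentLinear h i)
  comm' i j _ := restrict_freeBimod_hom_ext fun a => by
    have h₁ := incl_tensorDesc (componentLinear h i) a
    have h₂ := incl_tensorDesc (componentLinear h j) a
    have h₃ := incl_freeMap (k := k) (V.d i j) a
    refine (Category.assoc _ _ _).symm.trans ((h₁ =≫ _).trans (((h a).comm i j).trans ?_))
    refine Eq.trans ?_ ((Category.assoc _ _ _).symm.trans ((h₃ =≫ _).trans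
      (Category.assoc _ _ _))).symm
    exact congrArg (V.d i j ≫ ·) h₂.symm

lemma inclComplex_descComplex {V Z : CochainComplex (RightMod B) ℤ} (h : A →ₗ[k] (V ⟶ Z))
    (a : A) : inclComplex a V ≫ descComplex h = h a :=
  HomologicalComplex.hom_ext _ _ fun _ => incl_tensorDesc _ a

/-- When `A` is projective over `k`, a `k`-linear family of homotopy classes `V ⟶ Z` comes from
a homotopy class `A ⊗ V ⟶ Z`: choose representatives arbitrarily and make the choice `k`-linear
by means of a section of the canonical map from the free module on `A` to `A`. -/
lemma exists_htpy_desc (hA : Module.Projective k A) {V Z : HtpyCat B} (h : A →ₗ[k] (V ⟶ Z)) :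
    ∃ f : (resHtpy k A B).obj ((freeHtpy k A B).obj V) ⟶ Z, ∀ a, inclHtpy a V ≫ f = h a := by
  obtain ⟨V, rfl⟩ := HomotopyCategory.quotient_obj_surjective V
  obtain ⟨Z, rfl⟩ := HomotopyCategory.quotient_obj_surjective Z
  obtain ⟨s, hs⟩ := hA.out
  choose g hg using fun a => (toHtpy B).map_surjective (h a)
  refine ⟨(toHtpy B).map (descComplex ((Finsupp.linearCombination k g).comp s)), fun a => ?_⟩
  refine ((toHtpy B).map_comp _ _).symm.trans ?_
  refine (congrArg (toHtpy B).map (inclComplex_descComplex _ a)).trans ?_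
  change (toHtpy B).map (Finsupp.linearCombination k g (s a)) = h a
  have := Finsupp.apply_linearCombination k ((toHtpy B).mapLinearMap k (X := V) (Y := Z)) g (s a)
  refine this.trans ?_
  have h₂ : ((toHtpy B).mapLinearMap k (X := V) (Y := Z)) ∘ g = h := funext hg
  rw [h₂]
  have h₃ := Finsupp.apply_linearCombination k h id (s a)
  rw [Function.comp_id] at h₃
  rw [← h₃, hs a]

lemma incl_eq_linearCombination {V N : RightMod B} {s : A →ₗ[k] A →₀ k}
    (hs : Function.LeftInverse (Finsupp.linearCombination k id) s)
    (f : (restrictRight k A B).obj (freeBimod k A V) ⟶ N) (a : A) :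
    incl k a V ≫ f = Finsupp.linearCombination k (fun b => incl k b V ≫ f) (s a) := by
  have := Finsupp.apply_linearCombination k ((Linear.rightComp k V f).comp (inclLinear k V))
    id (s a)
  rw [hs a] at this
  exact this

/-- A null-homotopy of a map out of `A ⊗ V`, assembled from null-homotopies of its compositions
with the inclusions `v ↦ b ⊗ v`. -/
noncomputable def homotopyDesc {V Z : CochainComplex (RightMod B) ℤ} {s : A →ₗ[k] A →₀ k}
    (hs : Function.LeftInverse (Finsupp.linearCombination k id) s)
    (f : (resComplex k A B).obj ((freeComplex k A B).obj V) ⟶ Z)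
    (H : ∀ a, Homotopy (inclComplex a V ≫ f) 0) : Homotopy f 0 where
  hom i j := tensorDesc ((Finsupp.linearCombination k fun b => (H b).hom i j).comp s)
  zero i j hij := restrict_freeBimod_hom_ext fun a => by
    refine (incl_tensorDesc _ a).trans ?_
    have : (fun b => (H b).hom i j) = 0 := funext fun b => (H b).zero i j hij
    rw [this, Finsupp.linearCombination_zero]
    exact (Limits.comp_zero (f := incl k a (V.X i)) (Z := Z.X j)).symm
  comm i := restrict_freeBimod_hom_ext fun a => by
    refine (incl_eq_linearCombination hs (f.f i) a).trans ?_
    let c := ComplexShape.up ℤ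
    let D (i j : ℤ) := (Finsupp.linearCombination k fun b => (H b).hom i j).comp s
    have h₁ : incl k a (V.X i) ≫ tensorDesc (D i (c.prev i)) ≫ Z.d (c.prev i) i =
        D i (c.prev i) a ≫ Z.d (c.prev i) i := by
      rw [← Category.assoc, incl_tensorDesc]
    have h₂ : incl k a (V.X i) ≫ (restrictRight k A B).map (freeMap (V.d i (c.next i))) ≫
        tensorDesc (D (c.next i) i) = V.d i (c.next i) ≫ D (c.next i) i a := by
      rw [← Category.assoc]
      refine ((incl_freeMap (V.d i (c.next i)) a) =≫ _).trans ?_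
      rw [Category.assoc, incl_tensorDesc]
    have h₃ : Finsupp.linearCombination k (fun b => incl k b (V.X i) ≫ f.f i) (s a) =
        V.d i (c.next i) ≫ D (c.next i) i a + D i (c.prev i) a ≫ Z.d (c.prev i) i := by
      simp only [D, LinearMap.comp_apply, Finsupp.linearCombination_apply, Finsupp.sum,
        Preadditive.comp_sum, Preadditive.sum_comp, Linear.comp_smul, Linear.smul_comp,
        ← Finset.sum_add_distrib, ← smul_add]
      refine Finset.sum_congr rfl fun b _ => congrArg _ ?_
      exact ((H b).comm i).trans (add_zero _)
    rw [h₃, ← h₁, ← h₂, ← Preadditive.comp_add]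
    exact congrArg _ (add_zero _).symm

/-- When `A` is projective over `k`, a map out of `A ⊗ V` is null-homotopic if its composition
with each inclusion `v ↦ a ⊗ v` is. -/
lemma htpy_hom_ext (hA : Module.Projective k A) {V Z : HtpyCat B}
    {f g : (resHtpy k A B).obj ((freeHtpy k A B).obj V) ⟶ Z}
    (h : ∀ a, inclHtpy a V ≫ f = inclHtpy a V ≫ g) : f = g := by
  rw [← sub_eq_zero]
  replace h : ∀ a, inclHtpy a V ≫ (f - g) = 0 := fun a => by
    rw [Preadditive.comp_sub, h, sub_self]
  generalize f - g = f at h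
  obtain ⟨V, rfl⟩ := HomotopyCategory.quotient_obj_surjective V
  obtain ⟨Z, rfl⟩ := HomotopyCategory.quotient_obj_surjective Z
  obtain ⟨f, rfl⟩ : ∃ f' : (resComplex k A B).obj ((freeComplex k A B).obj V) ⟶ Z,
    (toHtpy B).map f' = f := (toHtpy B).map_surjective f
  obtain ⟨s, hs⟩ := hA.out
  have H : ∀ a, Nonempty (Homotopy (inclComplex a V ≫ f) 0) := fun a =>
    (HomotopyCategory.quotient_map_eq_zero_iff _).1 (((toHtpy B).map_comp _ _).trans (h a))
  exact (HomotopyCategory.quotient_map_eq_zero_iff f).2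
    ⟨homotopyDesc hs f fun a => (H a).some⟩

end FreeComplex

/-! ### Coproducts and right bounded complexes of projective objects in the homotopy category -/

section Coproducts

open Limits

variable {C : Type*} [Category* C] [Preadditive C] {κ ι : Type*} {c : ComplexShape κ}
  {X : ι → HomologicalComplex C c} {P : HomologicalComplex C c} {g : ∀ n, X n ⟶ P}

/-- Coproducts are invariant under replacing the summands by isomorphic objects. -/
noncomputable def isColimitCofanOfIso {D : Type*} [Category* D] {Y Y' : ι → D}
    (e : ∀ n, Y n ≅ Y' n) {Z : D} {f : ∀ n, Y' n ⟶ Z} (h : IsColimit (Cofan.mk Z f)) :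
    IsColimit (Cofan.mk Z fun n => (e n).hom ≫ f n) :=
  Cofan.IsColimit.mk _ (fun s => Cofan.IsColimit.desc h fun n => (e n).inv ≫ s.inj n)
    (fun s n => by
      have : f n ≫ Cofan.IsColimit.desc h (fun n => (e n).inv ≫ s.inj n) = (e n).inv ≫ s.inj n :=
        Cofan.IsColimit.fac h _ n
      change ((e n).hom ≫ f n) ≫ _ = _
      rw [Category.assoc, this, Iso.hom_inv_id_assoc])
    (fun s m hm => Cofan.IsColimit.hom_ext h _ _ fun n => by
      rw [Cofan.IsColimit.fac, ← hm n]
      change f n ≫ m = (e n).inv ≫ ((e n).hom ≫ f n) ≫ m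
      simp)

/-- The morphism of complexes out of a degreewise coproduct. -/
noncomputable def complexDesc (h : ∀ i, IsColimit (Cofan.mk (P.X i) fun n => (g n).f i))
    {Z : HomologicalComplex C c} (f : ∀ n, X n ⟶ Z) : P ⟶ Z where
  f i := Cofan.IsColimit.desc (h i) fun n => (f n).f i
  comm' i j _ := Cofan.IsColimit.hom_ext (h i) _ _ fun n => by
    have h₁ : (g n).f i ≫ Cofan.IsColimit.desc (h i) (fun n => (f n).f i) = (f n).f i :=
      Cofan.IsColimit.fac (h i) _ n
    have h₂ : (g n).f j ≫ Cofan.IsColimit.desc (h j) (fun n => (f n).f j) = (f n).f j :=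
      Cofan.IsColimit.fac (h j) _ n
    change (g n).f i ≫ _ = (g n).f i ≫ _
    rw [reassoc_of% h₁, (g n).comm_assoc, h₂, (f n).comm]

lemma comp_complexDesc (h : ∀ i, IsColimit (Cofan.mk (P.X i) fun n => (g n).f i))
    {Z : HomologicalComplex C c} (f : ∀ n, X n ⟶ Z) (n : ι) : g n ≫ complexDesc h f = f n :=
  HomologicalComplex.hom_ext _ _ fun i => Cofan.IsColimit.fac (h i) _ n

/-- Null-homotopies on the summands of a degreewise coproduct assemble. -/
noncomputable def homotopyOfCoproduct (h : ∀ i, IsColimit (Cofan.mk (P.X i) fun n => (g n).f i))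
    {Z : HomologicalComplex C c} (f : P ⟶ Z) (H : ∀ n, Homotopy (g n ≫ f) 0) : Homotopy f 0 where
  hom i j := Cofan.IsColimit.desc (h i) fun n => (H n).hom i j
  zero i j hij := Cofan.IsColimit.hom_ext (h i) _ _ fun n => by
    rw [Cofan.IsColimit.fac, (H n).zero i j hij, comp_zero]
  comm i := Cofan.IsColimit.hom_ext (h i) _ _ fun n => by
    let D (i j : κ) : P.X i ⟶ Z.X j := Cofan.IsColimit.desc (h i) fun n => (H n).hom i j
    have h₁ : ∀ i j, (g n).f i ≫ D i j = (H n).hom i j := fun i j => Cofan.IsColimit.fac (h i) _ n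
    change (g n).f i ≫ f.f i = (g n).f i ≫ (P.d i (c.next i) ≫ D (c.next i) i +
      D i (c.prev i) ≫ Z.d (c.prev i) i + 0)
    rw [Preadditive.comp_add, Preadditive.comp_add, (g n).comm_assoc, h₁, reassoc_of% h₁,
      comp_zero]
    exact (H n).comm i

/-- Degreewise coproducts of complexes are coproducts in the homotopy category. -/
lemma nonempty_isColimit_quotient
    (h : ∀ i, IsColimit (Cofan.mk (P.X i) fun n => (g n).f i)) :
    Nonempty (IsColimit (Cofan.mk ((HomotopyCategory.quotient C c).obj P)
      fun n => (HomotopyCategory.quotient C c).map (g n))) := by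
  have hdesc : ∀ (Z : HomotopyCategory C c)
      (f : ∀ n, (HomotopyCategory.quotient C c).obj (X n) ⟶ Z),
      ∃ d : (HomotopyCategory.quotient C c).obj P ⟶ Z,
        ∀ n, (HomotopyCategory.quotient C c).map (g n) ≫ d = f n := by
    intro Z f
    obtain ⟨Z, rfl⟩ := HomotopyCategory.quotient_obj_surjective Z
    choose f' hf' using fun n => (HomotopyCategory.quotient C c).map_surjective (f n)
    exact ⟨(HomotopyCategory.quotient C c).map (complexDesc h f'), fun n => by
      rw [← Functor.map_comp, comp_complexDesc, hf']⟩
  have hext : ∀ (Z : HomotopyCategory C c) (d : (HomotopyCategory.quotient C c).obj P ⟶ Z),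
      (∀ n, (HomotopyCategory.quotient C c).map (g n) ≫ d = 0) → d = 0 := by
    intro Z d hd
    obtain ⟨Z, rfl⟩ := HomotopyCategory.quotient_obj_surjective Z
    obtain ⟨d, rfl⟩ := (HomotopyCategory.quotient C c).map_surjective d
    simp only [← Functor.map_comp, HomotopyCategory.quotient_map_eq_zero_iff] at hd ⊢
    exact ⟨homotopyOfCoproduct h d fun n => (hd n).some⟩
  choose desc hdesc using hdesc
  refine ⟨Cofan.IsColimit.mk _ (fun s => desc s.pt s.inj) (fun s n => hdesc s.pt s.inj n)
    fun s m hm => ?_⟩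
  rw [← sub_eq_zero]
  refine hext _ _ fun n => ?_
  rw [Preadditive.comp_sub, hdesc, sub_eq_zero]
  exact hm n

end Coproducts

section BoundedProjective

open Limits Pretriangulated

variable (C : Type*) [Category* C] [Abelian C]

/-- The objects of the homotopy category which are homotopy equivalent to a complex of projective
objects vanishing in degrees `> N`. -/
def boundedProjective (N : ℤ) : ObjectProperty (HomotopyCategory C (ComplexShape.up ℤ)) :=
  fun X => ∃ K : CochainComplex C ℤ, K.IsStrictlyLE N ∧ (∀ i, Projective (K.X i)) ∧
    Nonempty (X ≅ (HomotopyCategory.quotient C _).obj K)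

variable {C}

lemma boundedProjective.mono {N N' : ℤ} (h : N ≤ N')
    {X : HomotopyCategory C (ComplexShape.up ℤ)} (hX : boundedProjective C N X) :
    boundedProjective C N' X := by
  obtain ⟨K, hK, hp, e⟩ := hX
  exact ⟨K, CochainComplex.isStrictlyLE_of_le K N N' h, hp, e⟩

/-- The cone of a map between complexes of projective objects has projective components. As the
cone involves a shift, the bound on the source may be larger by one. -/
lemma boundedProjective.obj₃ {N : ℤ} {Δ : Triangle (HomotopyCategory C (ComplexShape.up ℤ))}
    (hΔ : Δ ∈ distTriang _) (h₁ : boundedProjective C (N + 1) Δ.obj₁)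
    (h₂ : boundedProjective C N Δ.obj₂) : boundedProjective C N Δ.obj₃ := by
  obtain ⟨K, hK, hpK, ⟨eK⟩⟩ := h₁
  obtain ⟨L, hL, hpL, ⟨eL⟩⟩ := h₂
  obtain ⟨f, hf⟩ := (HomotopyCategory.quotient C (ComplexShape.up ℤ)).map_surjective
    (eK.inv ≫ Δ.mor₁ ≫ eL.hom)
  have e := isoTriangleOfIso₁₂ Δ _ hΔ
    (HomotopyCategory.mappingCone_triangleh_distinguished f) eK eL (by
      change Δ.mor₁ ≫ eL.hom = eK.hom ≫ (HomotopyCategory.quotient _ _).map f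
      rw [hf, Iso.hom_inv_id_assoc])
  have eX : ∀ i, (CochainComplex.mappingCone f).X i ≅ K.X (i + 1) ⊞ L.X i := fun i =>
    HomologicalComplex.homotopyCofiber.XIsoBiprod f i (i + 1) rfl
  refine ⟨CochainComplex.mappingCone f, ?_, fun i => Projective.of_iso (eX i).symm inferInstance,
    ⟨Triangle.π₃.mapIso e⟩⟩
  rw [CochainComplex.isStrictlyLE_iff]
  intro i hi
  exact ((biprod_isZero_iff _ _).2 ⟨K.isZero_of_isStrictlyLE (N + 1) _ (by lia),
    L.isZero_of_isStrictlyLE N _ hi⟩).of_iso (eX i)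

lemma boundedProjective.shift {N : ℤ} {X : HomotopyCategory C (ComplexShape.up ℤ)}
    (hX : boundedProjective C N X) : boundedProjective C (N + 1) (X⟦(-1 : ℤ)⟧) := by
  obtain ⟨K, hK, hp, ⟨e⟩⟩ := hX
  refine ⟨K⟦(-1 : ℤ)⟧, K.isStrictlyLE_shift N (-1) (N + 1) (by lia), fun i => hp _,
    ⟨(shiftFunctor _ (-1 : ℤ)).mapIso e ≪≫
      (((HomotopyCategory.quotient C (ComplexShape.up ℤ)).commShiftIso (-1 : ℤ)).app K).symm⟩⟩

lemma boundedProjective.obj₁ {N : ℤ} {Δ : Triangle (HomotopyCategory C (ComplexShape.up ℤ))}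
    (hΔ : Δ ∈ distTriang _) (h₂ : boundedProjective C N Δ.obj₂)
    (h₃ : boundedProjective C N Δ.obj₃) : boundedProjective C (N + 1) Δ.obj₁ :=
  boundedProjective.obj₃ (inv_rot_of_distTriang _ (inv_rot_of_distTriang _ hΔ))
    (h₂.shift.mono (by lia)) h₃.shift

lemma boundedProjective.map {C' : Type*} [Category* C'] [Abelian C'] (F : C ⥤ C') [F.Additive]
    (hF : ∀ Y : C, Projective Y → Projective (F.obj Y)) {N : ℤ}
    {X : HomotopyCategory C (ComplexShape.up ℤ)} (hX : boundedProjective C N X) :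
    boundedProjective C' N ((F.mapHomotopyCategory _).obj X) := by
  obtain ⟨K, hK, hp, ⟨e⟩⟩ := hX
  refine ⟨(F.mapHomologicalComplex _).obj K, ?_, fun i => hF _ (hp i),
    ⟨(F.mapHomotopyCategory _).mapIso e⟩⟩
  rw [CochainComplex.isStrictlyLE_iff]
  intro i hi
  exact F.map_isZero (K.isZero_of_isStrictlyLE N i hi)

/-- Degreewise coproducts show that `boundedProjective` is closed under countable coproducts, and
that these are preserved by the functor induced on homotopy categories by `R` if `R` preserves
coproducts. -/
lemma boundedProjective.exists_coproduct [HasCoproducts.{0} C] {C' : Type*} [Category* C']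
    [Preadditive C'] (R : C ⥤ C') [R.Additive] [PreservesColimitsOfSize.{0, 0} R] {N : ℤ}
    (X : ℕ → HomotopyCategory C (ComplexShape.up ℤ)) (hX : ∀ n, boundedProjective C N (X n)) :
    ∃ c : Cofan X, boundedProjective C N c.pt ∧ Nonempty (IsColimit c) ∧
      Nonempty (IsColimit (Cofan.mk ((R.mapHomotopyCategory _).obj c.pt)
        fun n => (R.mapHomotopyCategory _).map (c.inj n))) := by
  choose K hK hp e using hX
  replace e := fun n => (e n).some
  let P : CochainComplex C ℤ := ∐ K
  have hP : ∀ i, IsColimit (Cofan.mk (P.X i) fun n => (Sigma.ι K n).f i) := fun i =>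
    isColimitCofanMkObjOfIsColimit (HomologicalComplex.eval C (ComplexShape.up ℤ) i) K _
      (coproductIsCoproduct K)
  have hRP : ∀ i, IsColimit (Cofan.mk (((R.mapHomologicalComplex _).obj P).X i)
      fun n => ((R.mapHomologicalComplex _).map (Sigma.ι K n)).f i) := fun i =>
    isColimitCofanMkObjOfIsColimit R _ _ (hP i)
  let c : Cofan X := Cofan.mk ((HomotopyCategory.quotient C _).obj P)
    fun n => (e n).hom ≫ (HomotopyCategory.quotient C _).map (Sigma.ι K n)
  obtain ⟨hQ⟩ := nonempty_isColimit_quotient hP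
  obtain ⟨hRQ⟩ := nonempty_isColimit_quotient hRP
  refine ⟨c, ⟨P, ?_, fun i => ?_, ⟨Iso.refl _⟩⟩, ⟨isColimitCofanOfIso e hQ⟩, ?_⟩
  · rw [CochainComplex.isStrictlyLE_iff]
    intro i hi
    rw [IsZero.iff_id_eq_zero]
    exact Cofan.IsColimit.hom_ext (hP i) _ _ fun n =>
      ((K n).isZero_of_isStrictlyLE N i hi).eq_of_src _ _
  · have := fun n => hp n i
    exact
      { factors := fun f p _ => ⟨Cofan.IsColimit.desc (hP i) fun n =>
          Projective.factorThru ((Sigma.ι K n).f i ≫ f) p,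
          Cofan.IsColimit.hom_ext (hP i) _ _ fun n => by
            refine (Cofan.IsColimit.fac_assoc (hP i) _ _ _).trans ?_
            exact Projective.factorThru_comp _ _⟩ }
  · have h : (fun n => (R.mapHomotopyCategory _).map (c.inj n)) = fun n =>
        ((R.mapHomotopyCategory _).mapIso (e n)).hom ≫ (HomotopyCategory.quotient C' _).map
          ((R.mapHomologicalComplex _).map (Sigma.ι K n)) :=
      funext fun n => (R.mapHomotopyCategory _).map_comp _ _
    rw [h]
    exact ⟨isColimitCofanOfIso (fun n => (R.mapHomotopyCategory _).mapIso (e n)) hRQ⟩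

end BoundedProjective

/-! ### Projective bimodules -/

section ProjectiveBimodules

variable {k A B : Type u} [CommRing k] [Ring A] [Algebra k A] [Ring B] [Algebra k B]

lemma projective_freeFunctor_obj {V : RightMod B} (hV : Projective V) :
    Projective ((freeFunctor (k := k) (A := A)).obj V) :=
  freeAdjunction.map_projective V hV

/-- If `A` is projective over `k` then `A ⊗ V` is projective over `B` for each projective `V`:
the lifts of the maps `v ↦ a ⊗ v` along an epimorphism are made `k`-linear in `a` by means of a
section of the canonical map from the free module on `A` to `A`. -/
lemma projective_restrict_freeBimod (hA : Module.Projective k A) {V : RightMod B}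
    (hV : Projective V) : Projective ((restrictRight k A B).obj (freeBimod k A V)) where
  factors {E X} f p _ := by
    obtain ⟨s, hs⟩ := hA.out
    let l : A → (V ⟶ E) := fun a => Projective.factorThru (incl k a V ≫ f) p
    refine ⟨tensorDesc ((Finsupp.linearCombination k l).comp s),
      restrict_freeBimod_hom_ext fun a => ?_⟩
    rw [← Category.assoc, incl_tensorDesc, incl_eq_linearCombination hs f a]
    refine (Finsupp.apply_linearCombination k (Linear.rightComp k V p) l (s a)).trans ?_
    exact congrArg (fun t => Finsupp.linearCombination k t (s a))
      (funext fun b => Projective.factorThru_comp (incl k b V ≫ f) p)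

lemma projective_restrict (hA : Module.Projective k A) (Y : BimodCat k A B) (hY : Projective Y) :
    Projective ((restrictRight k A B).obj Y) := by
  let V := Projective.over ((restrictRight k A B).obj Y)
  let p : freeBimod k A V ⟶ Y :=
    freeMap (Projective.π ((restrictRight k A B).obj Y)) ≫ actionMap Y
  have hp : Epi p := by
    rw [ModuleCat.epi_iff_surjective]
    intro (y : Y)
    obtain ⟨v, hv⟩ := (ModuleCat.epi_iff_surjective
      (Projective.π ((restrictRight k A B).obj Y))).1 inferInstance y
    refine ⟨pureTensor 1 v, ?_⟩
    change (actionMap Y).hom ((freeMap _).hom (pureTensor 1 v : freeBimod k A V)) = y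
    rw [freeMap_pureTensor]
    exact (actionMap_pureTensor Y 1 _).trans ((one_smul (A ⊗[k] Bᵐᵒᵖ) _).trans hv)
  have r : Retract Y (freeBimod k A V) :=
    { i := Projective.factorThru (𝟙 Y) p
      r := p
      retract := Projective.factorThru_comp _ _ }
  have := projective_restrict_freeBimod hA (V := V) inferInstance
  exact (r.map (restrictRight k A B)).projective

end ProjectiveBimodules

/-! ### The universal complex of bimodules attached to a homotopy action -/

section UniversalLift

open Pretriangulated

variable {k A B : Type u} [CommRing k] [Ring A] [Algebra k A] [Ring B] [Algebra k B]
  {T : CochainComplex (RightMod B) ℤ}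

/-- A homotopy action as a `k`-linear family of morphisms of the homotopy category. -/
def actionLinear (α : HomotopyAction k A B T) :
    A →ₗ[k] ((toHtpy B).obj T ⟶ (toHtpy B).obj T) :=
  α.toLinearMap

lemma actionLinear_mul (α : HomotopyAction k A B T) (a b : A) :
    actionLinear α (a * b) = actionLinear α b ≫ actionLinear α a :=
  map_mul α a b

/-- A morphism is equivariant for the algebra structure `m` on `T` given by a homotopy action if
and only if it commutes with the actions of the elements of `A` up to homotopy. -/
lemma equivariant_iff (hA : Module.Projective k A) (α : HomotopyAction k A B T)
    {m : (resHtpy k A B).obj ((freeHtpy k A B).obj ((toHtpy B).obj T)) ⟶ (toHtpy B).obj T}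
    (hm : ∀ a, inclHtpy a _ ≫ m = actionLinear α a) (Y : CochainComplex (BimodCat k A B) ℤ)
    (f : (toHtpy B).obj T ⟶ (toHtpy B).obj ((resComplex k A B).obj Y)) :
    Equivariant (htpyAdjunction k A B) m ((HomotopyCategory.quotient _ _).obj Y) f ↔
      ∀ a, actionLinear α a ≫ f = f ≫ (toHtpy B).map (leftMul Y a) := by
  have h : ∀ a, inclHtpy a _ ≫ (resHtpy k A B).map ((freeHtpy k A B).map f) ≫
      (resHtpy k A B).map ((htpyAdjunction k A B).counit.app
        ((HomotopyCategory.quotient _ _).obj Y)) = f ≫ (toHtpy B).map (leftMul Y a) := fun a => by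
    refine (Category.assoc _ _ _).symm.trans ((inclHtpy_naturality a f =≫ _).trans
      ((Category.assoc _ _ _).trans (congrArg (f ≫ ·) (inclHtpy_counit a Y))))
  have h' : ∀ a, inclHtpy a _ ≫ m ≫ f = actionLinear α a ≫ f := fun a =>
    (Category.assoc _ _ _).symm.trans (hm a =≫ f)
  constructor
  · intro H a
    exact (h' a).symm.trans ((congrArg (inclHtpy a _ ≫ ·) H).symm.trans (h a))
  · intro H
    exact htpy_hom_ext hA fun a => (h a).trans ((H a).symm.trans (h' a).symm)

/-- The algebra structure over the monad `V ↦ A ⊗ V` given by a homotopy action is associative. -/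
lemma actionLinear_assoc (hA : Module.Projective k A) (α : HomotopyAction k A B T)
    {m : (resHtpy k A B).obj ((freeHtpy k A B).obj ((toHtpy B).obj T)) ⟶ (toHtpy B).obj T}
    (hm : ∀ a, inclHtpy a _ ≫ m = actionLinear α a) :
    (resHtpy k A B).map ((htpyAdjunction k A B).counit.app
        ((freeHtpy k A B).obj ((toHtpy B).obj T))) ≫ m =
      (resHtpy k A B).map ((freeHtpy k A B).map m) ≫ m := by
  refine htpy_hom_ext hA fun a => htpy_hom_ext hA fun b => ?_
  have h₁ : inclHtpy b ((toHtpy B).obj T) ≫ (toHtpy B).map (leftMul ((freeComplex k A B).obj T) a) =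
      inclHtpy (a * b) ((toHtpy B).obj T) :=
    ((toHtpy B).map_comp _ _).symm.trans (congrArg (toHtpy B).map (inclComplex_leftMul a b T))
  have h₂ : inclHtpy a _ ≫ (resHtpy k A B).map ((htpyAdjunction k A B).counit.app
        ((freeHtpy k A B).obj ((toHtpy B).obj T))) ≫ m =
      (toHtpy B).map (leftMul ((freeComplex k A B).obj T) a) ≫ m :=
    (Category.assoc _ _ _).symm.trans (inclHtpy_counit a ((freeComplex k A B).obj T) =≫ m)
  have h₃ : inclHtpy a _ ≫ (resHtpy k A B).map ((freeHtpy k A B).map m) ≫ m =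
      m ≫ actionLinear α a :=
    (Category.assoc _ _ _).symm.trans ((inclHtpy_naturality a m =≫ m).trans
      ((Category.assoc _ _ _).trans (congrArg (m ≫ ·) (hm a))))
  refine (congrArg (inclHtpy b _ ≫ ·) h₂).trans (Eq.trans ?_
    (congrArg (inclHtpy b _ ≫ ·) h₃).symm)
  refine (Category.assoc _ _ _).symm.trans ((h₁ =≫ m).trans ((hm (a * b)).trans ?_))
  refine (actionLinear_mul α a b).trans ?_
  exact (hm b =≫ actionLinear α a).symm.trans (Category.assoc _ _ _)

/-- `exists_universal_lift` for complexes: a homotopy action on `T` is induced by a strict action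
on a homotopy equivalent complex `C`, which is right bounded with components that are projective
as bimodules, and which has the universal property of `T` with respect to compatible maps to
sufficiently coconnective complexes of bimodules. -/
theorem exists_universal_bimodule_complex (hA : Module.Projective k A)
    (α : HomotopyAction k A B T) {N : ℤ} (hN : T.IsStrictlyLE N) (hT : ProjectiveComponents T)
    (hToda : negOrth ((toHtpy B).obj T) ((toHtpy B).obj T)) :
    ∃ C : CochainComplex (BimodCat k A B) ℤ, C.IsStrictlyLE N ∧ (∀ i, Projective (C.X i)) ∧
      ∃ e : (toHtpy B).obj T ≅ (toHtpy B).obj ((resComplex k A B).obj C),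
        (∀ a, actionLinear α a ≫ e.hom = e.hom ≫ (toHtpy B).map (leftMul C a)) ∧
        ∀ Y : CochainComplex (BimodCat k A B) ℤ,
          negOrth ((toHtpy B).obj T) ≤ negOrth ((toHtpy B).obj ((resComplex k A B).obj Y)) →
          (∀ f : (toHtpy B).obj T ⟶ (toHtpy B).obj ((resComplex k A B).obj Y),
            (∀ a, actionLinear α a ≫ f = f ≫ (toHtpy B).map (leftMul Y a)) →
            ∃ g : C ⟶ Y, e.hom ≫ (toHtpy B).map ((resComplex k A B).map g) = f) ∧
          ∀ g g' : C ⟶ Y, (toHtpy B).map ((resComplex k A B).map g) =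
              (toHtpy B).map ((resComplex k A B).map g') →
            (HomotopyCategory.quotient _ (ComplexShape.up ℤ)).map g =
              (HomotopyCategory.quotient _ _).map g' := by
  obtain ⟨m, hm⟩ := exists_htpy_desc hA (actionLinear α)
  have hT' : boundedProjective (RightMod B) N ((toHtpy B).obj T) :=
    ⟨T, hN, fun i => (IsProjective.iff_projective (T.X i)).1 (hT i), ⟨Iso.refl _⟩⟩
  have hF : ∀ {M : ℤ} {V : HtpyCat B}, boundedProjective (RightMod B) M V →
      boundedProjective (BimodCat k A B) M ((freeHtpy k A B).obj V) := fun hV =>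
    hV.map freeFunctor fun _ => projective_freeFunctor_obj
  obtain ⟨X, e, ⟨C, hC, hCp, ⟨i⟩⟩, he, h₁, h₂⟩ := exists_universal_lift
    (adj := htpyAdjunction k A B) (P := boundedProjective (BimodCat k A B) N) (m := m)
    -- the unit of the adjunction is the inclusion `v ↦ 1 ⊗ v`
    ((hm 1).trans (map_one α)) (actionLinear_assoc hA α hm) hToda
    (fun V Z h f => htpy_hom_ext hA fun a => by rw [h (inclHtpy a V ≫ f), h (inclHtpy a V ≫ 0)])
    (hF hT')
    (fun X r K i δ hΔ hX X' v j w hX' => boundedProjective.obj₃ hX'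
      (hF (boundedProjective.obj₁ hΔ
        (hX.map (restrictRight k A B) (projective_restrict hA)) hT')) hX)
    (fun Δ hΔ hΔ₁ hΔ₂ => boundedProjective.obj₃ hΔ (hΔ₁.mono (by lia)) hΔ₂)
    (fun X hX => boundedProjective.exists_coproduct (restrictRight k A B) X hX)
  let e' : (toHtpy B).obj T ≅ (toHtpy B).obj ((resComplex k A B).obj C) :=
    e ≪≫ (resHtpy k A B).mapIso i
  refine ⟨C, hC, hCp, e', (equivariant_iff hA α hm C e'.hom).1 ?_, fun Y hY => ⟨?_, ?_⟩⟩
  · change (resHtpy k A B).map ((freeHtpy k A B).map (e.hom ≫ (resHtpy k A B).map i.hom)) ≫ _ =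
      m ≫ e.hom ≫ (resHtpy k A B).map i.hom
    rw [Functor.map_comp, Functor.map_comp, Category.assoc, map_counit_naturality,
      ← Category.assoc, he, Category.assoc]
  · intro f hf
    obtain ⟨g, hg⟩ := h₁ ((HomotopyCategory.quotient _ _).obj Y) hY f
      ((equivariant_iff hA α hm Y f).2 hf)
    obtain ⟨g', hg'⟩ := (HomotopyCategory.quotient _ _).map_surjective (i.inv ≫ g)
    refine ⟨g', ?_⟩
    change (e.hom ≫ (resHtpy k A B).map i.hom) ≫
      (resHtpy k A B).map ((HomotopyCategory.quotient _ _).map g') = f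
    rw [hg', Category.assoc, ← Functor.map_comp, Iso.hom_inv_id_assoc, hg]
  · intro g g' hg
    have h : (resHtpy k A B).map (i.hom ≫ ((HomotopyCategory.quotient _ _).map g -
        (HomotopyCategory.quotient _ _).map g')) = 0 := by
      rw [Functor.map_comp, Functor.map_sub]
      exact (congrArg (_ ≫ ·) (sub_eq_zero.2 hg)).trans Limits.comp_zero
    have h' := h₂ ((HomotopyCategory.quotient _ _).obj Y) hY _ h
    rw [Preadditive.IsIso.comp_left_eq_zero] at h'
    exact sub_eq_zero.1 h'

end UniversalLift

/-! ### Restriction of morphisms between derived categories -/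

section Represents

variable {k A B : Type u} [CommRing k] [Ring A] [Algebra k A] [Ring B] [Algebra k B]

lemma isKProjective_of_rightBounded {K : CochainComplex (RightMod B) ℤ} (hK : RightBounded K)
    (hp : ProjectiveComponents K) : K.IsKProjective := by
  obtain ⟨N, _⟩ := hK
  have : ∀ i, Projective (K.X i) := fun i => (IsProjective.iff_projective (K.X i)).1 (hp i)
  exact CochainComplex.isKProjective_of_projective K N

lemma quasiIso_of_isIso_toHtpy_map {X Y : CochainComplex (BimodCat k A B) ℤ} (g : X ⟶ Y)
    (h : IsIso ((toHtpy B).map ((resComplex k A B).map g))) : QuasiIso g := by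
  rw [HomologicalComplex.isIso_quotient_map_iff_homotopyEquivalences] at h
  exact (HomologicalComplex.quasiIso_map_iff_of_preservesHomology g (restrictRight k A B)).1
    (homotopyEquivalences_le_quasiIso _ _ _ h)

variable {X Y Z : CochainComplex (BimodCat k A B) ℤ}

variable [HasDerivedCategory.{w₁} (BimodCat k A B)]

lemma exists_Q_map_eq [X.IsKProjective] (f : DerivedCategory.Q.obj X ⟶ DerivedCategory.Q.obj Y) :
    ∃ g : X ⟶ Y, DerivedCategory.Q.map g = f := by
  obtain ⟨g, hg⟩ := (CochainComplex.IsKProjective.Qh_map_bijective X _).2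
    ((DerivedCategory.quotientCompQhIso _).hom.app X ≫ f ≫
      (DerivedCategory.quotientCompQhIso _).inv.app Y)
  obtain ⟨g, rfl⟩ := (HomotopyCategory.quotient _ _).map_surjective g
  refine ⟨g, ?_⟩
  have := DerivedCategory.quotientCompQhIso_hom_naturality g
  rw [hg] at this
  simpa using this.symm

lemma Q_map_eq_of_quotient_map_eq {f g : X ⟶ Y}
    (h : (HomotopyCategory.quotient _ (ComplexShape.up ℤ)).map f =
      (HomotopyCategory.quotient _ _).map g) :
    DerivedCategory.Q.map f = DerivedCategory.Q.map g := by
  rw [← cancel_epi ((DerivedCategory.quotientCompQhIso _).hom.app X),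
    ← DerivedCategory.quotientCompQhIso_hom_naturality,
    ← DerivedCategory.quotientCompQhIso_hom_naturality, h]

variable [HasDerivedCategory.{w₂} (RightMod B)]

/-- The two ways of sending a complex of bimodules to the derived category of right modules. -/
noncomputable def resIso (X : CochainComplex (BimodCat k A B) ℤ) :
    (restrictRight k A B).mapDerivedCategory.obj (DerivedCategory.Q.obj X) ≅
      DerivedCategory.Qh.obj ((toHtpy B).obj ((resComplex k A B).obj X)) :=
  (restrictRight k A B).mapDerivedCategoryFactors.app X ≪≫
    ((DerivedCategory.quotientCompQhIso (RightMod B)).app _).symm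

lemma represents_iff
    {g : (toHtpy B).obj ((resComplex k A B).obj X) ⟶ (toHtpy B).obj ((resComplex k A B).obj Y)}
    {ψ : DerivedCategory.Q.obj X ⟶ DerivedCategory.Q.obj Y} :
    Represents g ψ ↔ (restrictRight k A B).mapDerivedCategory.map ψ ≫ (resIso Y).hom =
      (resIso X).hom ≫ DerivedCategory.Qh.map g := by
  unfold Represents
  rw [← cancel_mono ((DerivedCategory.quotientCompQhIso (RightMod B)).inv.app
    ((resComplex k A B).obj Y))]
  simp [resIso]

lemma represents_map (g : X ⟶ Y) :
    Represents ((toHtpy B).map ((resComplex k A B).map g)) (DerivedCategory.Q.map g) := by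
  unfold Represents
  rw [Functor.mapDerivedCategoryFactors_hom_naturality,
    DerivedCategory.quotientCompQhIso_hom_naturality]
  simp

lemma Represents.comp
    {g : (toHtpy B).obj ((resComplex k A B).obj X) ⟶ (toHtpy B).obj ((resComplex k A B).obj Y)}
    {h : (toHtpy B).obj ((resComplex k A B).obj Y) ⟶ (toHtpy B).obj ((resComplex k A B).obj Z)}
    {ψ : DerivedCategory.Q.obj X ⟶ DerivedCategory.Q.obj Y}
    {χ : DerivedCategory.Q.obj Y ⟶ DerivedCategory.Q.obj Z}
    (hg : Represents g ψ) (hh : Represents h χ) : Represents (g ≫ h) (ψ ≫ χ) := by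
  rw [represents_iff] at hg hh ⊢
  rw [Functor.map_comp, Functor.map_comp, Category.assoc, hh, reassoc_of% hg]

lemma Represents.of_comp
    {g : (toHtpy B).obj ((resComplex k A B).obj X) ⟶ (toHtpy B).obj ((resComplex k A B).obj Y)}
    {h : (toHtpy B).obj ((resComplex k A B).obj Y) ⟶ (toHtpy B).obj ((resComplex k A B).obj Z)}
    {ψ : DerivedCategory.Q.obj X ⟶ DerivedCategory.Q.obj Y}
    {χ : DerivedCategory.Q.obj Y ⟶ DerivedCategory.Q.obj Z} [IsIso ψ]
    (hg : Represents g ψ) (hc : Represents (g ≫ h) (ψ ≫ χ)) : Represents h χ := by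
  rw [represents_iff] at hg hc ⊢
  rw [Functor.map_comp, Functor.map_comp, Category.assoc, ← reassoc_of% hg] at hc
  rwa [cancel_epi] at hc

/-- A morphism of the derived category out of a right bounded complex with projective components
is represented by at most one homotopy class. -/
lemma Represents.unique [((resComplex k A B).obj X).IsKProjective]
    {g h : (toHtpy B).obj ((resComplex k A B).obj X) ⟶ (toHtpy B).obj ((resComplex k A B).obj Y)}
    {ψ : DerivedCategory.Q.obj X ⟶ DerivedCategory.Q.obj Y}
    (hg : Represents g ψ) (hh : Represents h ψ) : g = h := by
  rw [represents_iff] at hg hh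
  exact (CochainComplex.IsKProjective.Qh_map_bijective _ _).1
    ((cancel_epi _).1 (hg.symm.trans hh))

end Represents

section Strictification

variable {k A B : Type u} [CommRing k] [Ring A] [Algebra k A] [Ring B] [Algebra k B]
  {T : CochainComplex (RightMod B) ℤ} {α : HomotopyAction k A B T}

lemma negOrth_toHtpy {V : HtpyCat B} (h : ∀ n : ℤ, 0 < n →
    ∀ f : V ⟶ (toHtpy B).obj (T⟦-n⟧), f = 0) : negOrth ((toHtpy B).obj T) V := fun n hn f => by
  have := h n hn (f ≫ ((toHtpy B).commShiftIso (-n)).inv.app T)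
  rwa [Preadditive.IsIso.comp_right_eq_zero] at this

lemma compatible_iff {X : CochainComplex (BimodCat k A B) ℤ}
    {φ : T ⟶ (resComplex k A B).obj X} : Compatible α (inducedHomotopyAction X) φ ↔
      ∀ a, actionLinear α a ≫ (toHtpy B).map φ = (toHtpy B).map φ ≫ (toHtpy B).map (leftMul X a) :=
  Iff.rfl

lemma IsStrictification.isIso_map {X : CochainComplex (BimodCat k A B) ℤ}
    {φ : T ⟶ (resComplex k A B).obj X} (h : IsStrictification α X φ) [T.IsKProjective] :
    IsIso ((toHtpy B).map φ) := by
  have := isKProjective_of_rightBounded h.rightBounded h.projective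
  rw [HomologicalComplex.isIso_quotient_map_iff_homotopyEquivalences,
    ← CochainComplex.IsKProjective.quasiIso_iff]
  exact h.quasiIso

end Strictification

end HomotopyActions

open CategoryTheory HomotopyActions in
theorem theorem2p1 {k A B : Type u} [CommRing k] [Ring A] [Algebra k A] [Ring B] [Algebra k B]
    [HasDerivedCategory.{w₁} (BimodCat k A B)] [HasDerivedCategory.{w₂} (RightMod B)]
    (hA : Module.Projective k A)
    (T : CochainComplex (RightMod B) ℤ) (α : HomotopyAction k A B T)
    (hTbounded : RightBounded T) (hTproj : ProjectiveComponents T)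
    (hToda : ∀ n : ℤ, 0 < n →
      ∀ f : (toHtpy B).obj T ⟶ (toHtpy B).obj (T⟦-n⟧), f = 0) :
    (∃ (X : CochainComplex (BimodCat k A B) ℤ) (φ : T ⟶ (resComplex k A B).obj X),
      IsStrictification α X φ) ∧
    (∀ (X X' : CochainComplex (BimodCat k A B) ℤ)
      (φ : T ⟶ (resComplex k A B).obj X) (φ' : T ⟶ (resComplex k A B).obj X'),
      IsStrictification α X φ → IsStrictification α X' φ' →
      ∃! ψ : DerivedCategory.Q.obj X ≅ DerivedCategory.Q.obj X',
        ∃ g : (toHtpy B).obj ((resComplex k A B).obj X) ⟶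
            (toHtpy B).obj ((resComplex k A B).obj X'),
          Represents g ψ.hom ∧ (toHtpy B).map φ ≫ g = (toHtpy B).map φ') := by
  have hTp := isKProjective_of_rightBounded hTbounded hTproj
  obtain ⟨N, hN⟩ := hTbounded
  obtain ⟨C, hC, hCp, e, he, hlift⟩ := exists_universal_bimodule_complex hA α hN hTproj
    (negOrth_toHtpy hToda)
  have hresC : RightBounded ((resComplex k A B).obj C) := ⟨N, by
    rw [CochainComplex.isStrictlyLE_iff]
    intro i hi
    exact (restrictRight k A B).map_isZero (C.isZero_of_isStrictlyLE N i hi)⟩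
  have hresCp : ProjectiveComponents ((resComplex k A B).obj C) := fun i =>
    (IsProjective.iff_projective _).2 (projective_restrict hA _ (hCp i))
  have hresCK := isKProjective_of_rightBounded hresC hresCp
  have hCK : C.IsKProjective := CochainComplex.isKProjective_of_projective C N
  constructor
  · obtain ⟨φ, hφ⟩ := (toHtpy B).map_surjective e.hom
    refine ⟨C, φ, hresC, hresCp, ?_, compatible_iff.2 fun a => ?_⟩
    · rw [CochainComplex.IsKProjective.quasiIso_iff,
        ← HomologicalComplex.isIso_quotient_map_iff_homotopyEquivalences]
      exact hφ ▸ inferInstance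
    · rw [hφ]
      exact he a
  · have hrel : ∀ (X : CochainComplex (BimodCat k A B) ℤ) (φ : T ⟶ (resComplex k A B).obj X),
        IsStrictification α X φ →
        negOrth ((toHtpy B).obj T) ≤ negOrth ((toHtpy B).obj ((resComplex k A B).obj X)) := by
      intro X φ hφ V hV
      have := hφ.isIso_map
      exact hV.of_iso_right (asIso ((toHtpy B).map φ))
    -- a strictification is the target of a quasi-isomorphism from the universal complex `C`
    have key : ∀ (X : CochainComplex (BimodCat k A B) ℤ) (φ : T ⟶ (resComplex k A B).obj X),
        IsStrictification α X φ → ∃ g : C ⟶ X, IsIso (DerivedCategory.Q.map g) ∧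
          IsIso ((toHtpy B).map ((resComplex k A B).map g)) ∧
          e.hom ≫ (toHtpy B).map ((resComplex k A B).map g) = (toHtpy B).map φ := by
      intro X φ hφ
      have := hφ.isIso_map
      obtain ⟨g, hg⟩ := (hlift X (hrel X φ hφ)).1 _ (compatible_iff.1 hφ.compatible)
      have hi : IsIso ((toHtpy B).map ((resComplex k A B).map g)) :=
        IsIso.of_isIso_fac_left hg
      exact ⟨g, (DerivedCategory.isIso_Q_map_iff_quasiIso _ g).2
        (quasiIso_of_isIso_toHtpy_map g hi), hi, hg⟩
    intro X X' φ φ' hφ hφ'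
    obtain ⟨g, hQ, hg, hgφ⟩ := key X φ hφ
    obtain ⟨g', hQ', hg', hgφ'⟩ := key X' φ' hφ'
    refine ⟨(asIso (DerivedCategory.Q.map g)).symm ≪≫ asIso (DerivedCategory.Q.map g'),
      ⟨inv ((toHtpy B).map ((resComplex k A B).map g)) ≫
        (toHtpy B).map ((resComplex k A B).map g'), (represents_map g).of_comp ?_, ?_⟩, ?_⟩
    · simpa using represents_map g'
    · rw [← hgφ, Category.assoc, IsIso.hom_inv_id_assoc, hgφ']
    · rintro ψ ⟨h, hψ, hh⟩
      -- `g ≫ ψ` is the class of a map `l : C ⟶ X'` since `C` is K-projective; it agrees with `g'`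
      -- after restriction, hence up to homotopy of maps of complexes of bimodules
      obtain ⟨l, hl⟩ := exists_Q_map_eq (DerivedCategory.Q.map g ≫ ψ.hom)
      have hlh : (toHtpy B).map ((resComplex k A B).map l) =
          (toHtpy B).map ((resComplex k A B).map g) ≫ h :=
        (represents_map l).unique (hl ▸ (represents_map g).comp hψ)
      have hlg : (toHtpy B).map ((resComplex k A B).map l) =
          (toHtpy B).map ((resComplex k A B).map g') := by
        rw [← cancel_epi e.hom, hlh, reassoc_of% hgφ, hh, hgφ']
      have := Q_map_eq_of_quotient_map_eq ((hlift X' (hrel X' φ' hφ')).2 l g' hlg)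
      ext
      rw [Iso.trans_hom, Iso.symm_hom, asIso_inv, asIso_hom, ← this, hl, IsIso.inv_hom_id_assoc]
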